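/- Let $\mathcal H=\mathbb C^d$. A \emph{Lindbladian} is a superoperator of the form $X\mapsto -i[H,X]+\sum_k\big(L_kXL_k^\dagger-\tfrac12\{L_k^\dagger L_k,X\}\big)$ with $H$ Hermitian and finitely many jump operators $L_k$. A \emph{time-dependent Lindbladian} is a family $\mathcal L_t$, $t\ge 0$, of Lindbladians with locally integrable components; its time-evolution channel is the time-ordered exponential (Dyson series) $\mathcal E_{t,s}=\mathcal T\exp\big(\int_s^t\mathcal L_\tau\,d\tau\big)$. It is \emph{exponentially contractive with constants} $K,\gamma>0$ if $$\|\mathcal E_{t,s}(\rho-\sigma)\|_1\le K e^{-\gamma|t-s|}\|\rho-\sigma\|_1$$ for all density matrices $\rho,\sigma$ and all $t\ge s\ge 0$, where $\|\cdot\|_1$ is the trace norm. For a superoperator $T$ put $|||T|||_{1\to1}=\sup_{X\ne0}\|T(X)\|_1/\|X\|_1$. \textbf{Lemma.} Let $\mathcal L_t$ be a time-dependent Lindbladian that is exponentially contractive with constants $K,\gamma>0$, and let $\tilde{\mathcal L}_t$ be a time-dependent Lindbladian such that $$\Delta\mathcal L:=\sup_{t\ge0}|||\tilde{\mathcal L}_t-\mathcal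 L_t|||_{1\to1}<\frac{\gamma}{1+\ln K}.$$ Then $\tilde{\mathcal L}_t$ is exponentially contractive. Moreover, put, for $x>0$, $$r(x)=-\frac{\gamma}{x}\ln\Big(\frac{1+\ln K}{\gamma}\,\Delta\mathcal L+K\Big(1-\frac{\Delta\mathcal L}{\gamma}\Big)e^{-x}\Big).$$ \begin{itemize} \item If $K>1$ and $\Delta\mathcal L>0$, then $r$ has a unique maximizer $x$ on $(0,\infty)$, and $\tilde{\mathcal L}_t$ is exponentially contractive with constants $\tilde K=e^{x\tilde\gamma/\gamma}$ and $\tilde\gamma=r(x)=\max_{y>0}r(y)>0$. \item If $K=1$, then $\sup_{x>0}r(x)=\lim_{x\to0^+}r(x)=\gamma-\Delta\mathcal L$, and $\tilde{\mathcal L}_t$ is exponentially contractive with constants $\tilde K=1$ and $\tilde\gamma=\gamma-\Delta\mathcal L$. \item If $\Delta\mathcal L=0$, then $\tilde{\mathcal L}_t$ is exponentially contractive with constants $\tilde K=K$ and $\tilde\gamma=\gamma$; if moreover $K>1$, then $\sup_{x>0}r(x)=\gamma$. \end{itemize} -/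

import Mathlib

open Set MeasureTheory

noncomputable section

/-- Linear superoperators on the operators of the Hilbert space `ℂ^d`. -/
abbrev Superoperator (d : ℕ) : Type :=
  Matrix (Fin d) (Fin d) ℂ →ₗ[ℂ] Matrix (Fin d) (Fin d) ℂ

/-- The Schatten 1-norm (trace norm): the sum of the singular values. -/
def traceNorm {d : ℕ} (A : Matrix (Fin d) (Fin d) ℂ) : ℝ :=
  ∑ i : Fin d, (Matrix.toEuclideanLin A).singularValues i

/-- The `1 → 1` superoperator norm, the supremum of `‖T X‖₁ / ‖X‖₁` over nonzero `X`.
The supremum is finite, since the space of matrices is finite dimensional. -/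
def superopNorm {d : ℕ} (T : Superoperator d) : ℝ :=
  ⨆ X : {X : Matrix (Fin d) (Fin d) ℂ // X ≠ 0}, traceNorm (T X) / traceNorm X.1

open scoped ComplexOrder in
/-- Quantum states: positive semidefinite operators of trace one. -/
def IsDensityMatrix {d : ℕ} (ρ : Matrix (Fin d) (Fin d) ℂ) : Prop :=
  ρ.PosSemidef ∧ ρ.trace = 1

open scoped Matrix in
/-- A superoperator is a Lindbladian if it has the form
`X ↦ -i[H, X] + ∑ k, (Lₖ X Lₖ† - {Lₖ† Lₖ, X} / 2)` with a Hermitian Hamiltonian `H` and finitely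
many jump operators `Lₖ`. -/
def IsLindbladian {d : ℕ} (T : Superoperator d) : Prop :=
  ∃ (H : Matrix (Fin d) (Fin d) ℂ) (m : ℕ) (L : Fin m → Matrix (Fin d) (Fin d) ℂ),
    H.IsHermitian ∧
    ∀ X : Matrix (Fin d) (Fin d) ℂ,
      T X = (-Complex.I) • (H * X - X * H) +
        ∑ k, (L k * X * (L k)ᴴ - (1 / 2 : ℂ) • ((L k)ᴴ * L k * X + X * ((L k)ᴴ * L k)))

/-- A time-dependent Lindbladian, for times `t ≥ 0`: a Lindbladian at every time, with locally
integrable components. (Hamiltonian and jump operators may both depend on time.) -/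
structure IsTimeDependentLindbladian {d : ℕ} (𝓛 : ℝ → Superoperator d) : Prop where
  isLindbladian : ∀ t, 0 ≤ t → IsLindbladian (𝓛 t)
  locallyIntegrable : ∀ (X : Matrix (Fin d) (Fin d) ℂ) (i j : Fin d),
    LocallyIntegrableOn (fun t => 𝓛 t X i j) (Ici 0)

/-- The `n`-th term of the time-ordered exponential applied to `X`, that is
`∫_{s ≤ t₁ ≤ ⋯ ≤ tₙ ≤ t} 𝓛_{tₙ} ⋯ 𝓛_{t₁} X dt₁ ⋯ dtₙ`; the integrals are taken entrywise. -/
def dysonTerm {d : ℕ} (𝓛 : ℝ → Superoperator d) (s : ℝ) (X : Matrix (Fin d) (Fin d) ℂ) :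
    ℕ → ℝ → Matrix (Fin d) (Fin d) ℂ
  | 0, _ => X
  | n + 1, t => Matrix.of fun i j => ∫ τ in s..t, 𝓛 τ (dysonTerm 𝓛 s X n τ) i j

/-- The time-evolution channel `𝓔_{t,s} = 𝓣 exp (∫_s^t 𝓛_τ dτ)` applied to `X`: the sum of the
Dyson series. -/
def timeEvolution {d : ℕ} (𝓛 : ℝ → Superoperator d) (t s : ℝ) (X : Matrix (Fin d) (Fin d) ℂ) :
    Matrix (Fin d) (Fin d) ℂ :=
  ∑' n : ℕ, dysonTerm 𝓛 s X n t

/-- `𝓛` is exponentially contractive with constants `K, γ > 0`. -/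
def IsExpContractiveWith {d : ℕ} (𝓛 : ℝ → Superoperator d) (K γ : ℝ) : Prop :=
  0 < K ∧ 0 < γ ∧
    ∀ ρ σ : Matrix (Fin d) (Fin d) ℂ, IsDensityMatrix ρ → IsDensityMatrix σ →
      ∀ s t : ℝ, 0 ≤ s → s ≤ t →
        traceNorm (timeEvolution 𝓛 t s (ρ - σ)) ≤
          K * Real.exp (-γ * |t - s|) * traceNorm (ρ - σ)

/-- `𝓛` is exponentially contractive. -/
def IsExpContractive {d : ℕ} (𝓛 : ℝ → Superoperator d) : Prop :=
  ∃ K γ : ℝ, IsExpContractiveWith 𝓛 K γ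

/-- The function of `x > 0` that is maximized to obtain the perturbed contraction rate. -/
def perturbedRate (K γ Δ x : ℝ) : ℝ :=
  -(γ / x) * Real.log ((1 + Real.log K) / γ * Δ + K * (1 - Δ / γ) * Real.exp (-x))

end

/-! Let `y` evolve under the perturbed `𝓛'` from a traceless Hermitian `X` at time `s`. Running `𝓛'`
up to time `τ` and `𝓛` from then on gives a path from `𝓔_{t,s} X` (at `τ = s`) to `y t` (at `τ =
t`). Moving the switch by `dτ` injects a traceless Hermitian error of trace norm at most `Δ ‖X‖₁
dτ`, of which at most the fraction `min 1 (K e^{-γ(t-τ)})` survives at time `t`. Integrating (the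
bound 1 on the last `ln K / γ` units of time, the exponential before) and adding `‖𝓔_{t,s} X‖₁ ≤ K
e^{-γ(t-s)} ‖X‖₁` yields `traceNorm_perturbed_le`. With `x = γ(t-s)` its factor is `exp(-r(x) x /
γ)`, so repeating it on blocks of length `x / γ` gives the rate `r(x)`
(`traceNorm_le_exp_mul_of_step`).

That evolutions do not increase the trace norm is obtained from dissipativity instead of complete
positivity. Paired with the sign of `X`, a Lindbladian has nonpositive real trace
(`re_trace_sign_mul_lindbladian_le`), and `traceNorm_le_add_of_re_trace_le` integrates such
first-order bounds along absolutely continuous paths. Contraction, uniqueness and the perturbation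
bound all come from this. What remains is one-variable calculus for `r`. -/

/-! ### Trace norm, entry norm and spectral calculus of Hermitian matrices. -/

noncomputable section TraceNorm

open scoped Matrix ComplexOrder

variable {d : ℕ}

lemma traceNorm_nonneg (A : Matrix (Fin d) (Fin d) ℂ) : 0 ≤ traceNorm A :=
  Finset.sum_nonneg fun _ _ => LinearMap.singularValues_nonneg _ _

/-- The two eigenvalue families differ only by the proof of the dimension and a reindexing of `Fin
d`, which a sum does not see. -/
lemma Matrix.IsHermitian.sum_eigenvalues_eq {A : Matrix (Fin d) (Fin d) ℂ} (hA : A.IsHermitian)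
    (hT : (Matrix.toEuclideanLin A).IsSymmetric)
    (hn : Module.finrank ℂ (EuclideanSpace ℂ (Fin d)) = d) (g : ℝ → ℝ) :
    ∑ i, g (hT.eigenvalues hn i) = ∑ i, g (hA.eigenvalues i) := by
  have key : ∀ (m : ℕ) (hm : Module.finrank ℂ (EuclideanSpace ℂ (Fin d)) = m),
      ∑ i, g (hT.eigenvalues hn i) = ∑ i, g (hT.eigenvalues hm i) := by
    intro m hm
    obtain rfl : d = m := hn.symm.trans hm
    rfl
  rw [key _ finrank_euclideanSpace]
  exact (Equiv.sum_comp
    (Fintype.equivOfCardEq (Fintype.card_fin _) : Fin (Fintype.card (Fin d)) ≃ Fin d).symm _).symm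

lemma traceNorm_eq_sum_sqrt (A : Matrix (Fin d) (Fin d) ℂ) :
    traceNorm A =
      ∑ i, √((Matrix.isHermitian_conjTranspose_mul_self A).eigenvalues i) := by
  have hn : Module.finrank ℂ (EuclideanSpace ℂ (Fin d)) = d := by simp
  have hT := (Matrix.toEuclideanLin A).isSymmetric_adjoint_comp_self
  have hcomp : (Matrix.toEuclideanLin A).adjoint ∘ₗ Matrix.toEuclideanLin A =
      Matrix.toEuclideanLin (Aᴴ * A) := by
    rw [← Matrix.toEuclideanLin_conjTranspose_eq_adjoint]
    ext x i
    simp [Matrix.toLpLin_apply, Matrix.mulVec_mulVec]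
  unfold traceNorm
  simp_rw [LinearMap.singularValues_fin _ hn]
  have hT' : (Matrix.toEuclideanLin (Aᴴ * A)).IsSymmetric := hcomp ▸ hT
  rw [← Matrix.IsHermitian.sum_eigenvalues_eq _ hT' hn Real.sqrt]
  congr! 3

/-- Sum of the absolute values of the entries. -/
def entryNorm (A : Matrix (Fin d) (Fin d) ℂ) : ℝ := ∑ i, ∑ j, ‖A i j‖

lemma entryNorm_nonneg (A : Matrix (Fin d) (Fin d) ℂ) : 0 ≤ entryNorm A :=
  Finset.sum_nonneg fun _ _ => Finset.sum_nonneg fun _ _ => norm_nonneg _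

lemma norm_entry_le_entryNorm (A : Matrix (Fin d) (Fin d) ℂ) (i j : Fin d) :
    ‖A i j‖ ≤ entryNorm A :=
  (Finset.single_le_sum (f := fun j => ‖A i j‖) (fun _ _ => norm_nonneg _)
    (Finset.mem_univ j)).trans <|
  Finset.single_le_sum (f := fun i => ∑ j, ‖A i j‖)
    (fun _ _ => Finset.sum_nonneg fun _ _ => norm_nonneg _) (Finset.mem_univ i)

lemma sum_eigenvalues_conjTranspose_mul_self (A : Matrix (Fin d) (Fin d) ℂ) :
    ∑ i, (Matrix.isHermitian_conjTranspose_mul_self A).eigenvalues i =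
      ∑ i, ∑ j, ‖A i j‖ ^ 2 := by
  have h := (Matrix.isHermitian_conjTranspose_mul_self A).trace_eq_sum_eigenvalues
  have h2 : (Aᴴ * A).trace = ((∑ i, ∑ j, ‖A i j‖ ^ 2 : ℝ) : ℂ) := by
    rw [Finset.sum_comm]
    simp [Matrix.trace, Matrix.mul_apply, Complex.conj_mul']
  rw [h2] at h
  simp only [Complex.coe_algebraMap, ← Complex.ofReal_sum] at h
  exact_mod_cast h.symm

/-- Together with `entryNorm_le_traceNorm`, this lets entrywise integrals control the trace norm.
Both compare with the Frobenius norm; the constants are crude and do not enter the final rates. -/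
lemma traceNorm_le_entryNorm (A : Matrix (Fin d) (Fin d) ℂ) :
    traceNorm A ≤ d * entryNorm A := by
  rw [traceNorm_eq_sum_sqrt]
  have hpos : ∀ i, 0 ≤ (Matrix.isHermitian_conjTranspose_mul_self A).eigenvalues i :=
    Matrix.eigenvalues_conjTranspose_mul_self_nonneg A
  have h2 : ∑ i, ∑ j, ‖A i j‖ ^ 2 ≤ entryNorm A ^ 2 := by
    calc ∑ i, ∑ j, ‖A i j‖ ^ 2 ≤ ∑ i, ∑ j, ‖A i j‖ * entryNorm A := by
          refine Finset.sum_le_sum fun i _ => Finset.sum_le_sum fun j _ => ?_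
          rw [sq]
          exact mul_le_mul_of_nonneg_left (norm_entry_le_entryNorm A i j) (norm_nonneg _)
      _ = entryNorm A ^ 2 := by simp_rw [← Finset.sum_mul]; rw [sq]; rfl
  calc _ ≤ ∑ _i : Fin d, entryNorm A := by
        refine Finset.sum_le_sum fun i _ => Real.sqrt_le_iff.2 ⟨entryNorm_nonneg A, ?_⟩
        refine le_trans ?_ h2
        rw [← sum_eigenvalues_conjTranspose_mul_self]
        exact Finset.single_le_sum (fun i _ => hpos i) (Finset.mem_univ i)
    _ = _ := by simp

lemma entryNorm_le_traceNorm (A : Matrix (Fin d) (Fin d) ℂ) :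
    entryNorm A ≤ d * d * traceNorm A := by
  have hpos : ∀ i, 0 ≤ (Matrix.isHermitian_conjTranspose_mul_self A).eigenvalues i :=
    Matrix.eigenvalues_conjTranspose_mul_self_nonneg A
  have h1 : ∑ i, ∑ j, ‖A i j‖ ^ 2 ≤ traceNorm A ^ 2 := by
    rw [← sum_eigenvalues_conjTranspose_mul_self, traceNorm_eq_sum_sqrt]
    calc _ = ∑ i, √((Matrix.isHermitian_conjTranspose_mul_self A).eigenvalues i) ^ 2 :=
          Finset.sum_congr rfl fun i _ => (Real.sq_sqrt (hpos i)).symm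
      _ ≤ _ := Finset.sum_sq_le_sq_sum_of_nonneg fun i _ => Real.sqrt_nonneg _
  have h2 : ∀ i j, ‖A i j‖ ≤ traceNorm A := fun i j => by
    refine (sq_le_sq₀ (norm_nonneg _) (traceNorm_nonneg A)).1 (le_trans ?_ h1)
    exact (Finset.single_le_sum (f := fun j => ‖A i j‖ ^ 2) (fun _ _ => by positivity)
      (Finset.mem_univ j)).trans <|
      Finset.single_le_sum (f := fun i => ∑ j, ‖A i j‖ ^ 2)
        (fun _ _ => Finset.sum_nonneg fun _ _ => by positivity) (Finset.mem_univ i)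
  calc entryNorm A ≤ ∑ _i : Fin d, ∑ _j : Fin d, traceNorm A :=
        Finset.sum_le_sum fun i _ => Finset.sum_le_sum fun j _ => h2 i j
    _ = _ := by simp [mul_assoc]

/-- A function of the eigenvalues of a Hermitian matrix, as a matrix. -/
def spectralMatrix {X : Matrix (Fin d) (Fin d) ℂ} (hX : X.IsHermitian) (g : ℝ → ℝ) :
    Matrix (Fin d) (Fin d) ℂ :=
  (hX.eigenvectorUnitary : Matrix (Fin d) (Fin d) ℂ) *
    Matrix.diagonal (fun i => (g (hX.eigenvalues i) : ℂ)) *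
    (hX.eigenvectorUnitary : Matrix (Fin d) (Fin d) ℂ)ᴴ

section spectralMatrix

variable {X : Matrix (Fin d) (Fin d) ℂ} (hX : X.IsHermitian)

lemma eigenvectorUnitary_conjTranspose_mul :
    (hX.eigenvectorUnitary : Matrix (Fin d) (Fin d) ℂ)ᴴ *
      (hX.eigenvectorUnitary : Matrix (Fin d) (Fin d) ℂ) = 1 :=
  Unitary.coe_star_mul_self hX.eigenvectorUnitary

lemma eigenvectorUnitary_mul_conjTranspose :
    (hX.eigenvectorUnitary : Matrix (Fin d) (Fin d) ℂ) *
      (hX.eigenvectorUnitary : Matrix (Fin d) (Fin d) ℂ)ᴴ = 1 :=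
  Unitary.coe_mul_star_self hX.eigenvectorUnitary

lemma spectralMatrix_id : spectralMatrix hX (fun x => x) = X :=
  hX.spectral_theorem.symm

lemma spectralMatrix_one : spectralMatrix hX (fun _ => 1) = 1 := by
  simp [spectralMatrix, eigenvectorUnitary_mul_conjTranspose]

lemma spectralMatrix_add (g h : ℝ → ℝ) :
    spectralMatrix hX g + spectralMatrix hX h = spectralMatrix hX (fun x => g x + h x) := by
  simp [spectralMatrix, ← add_mul, ← mul_add]

lemma spectralMatrix_sub (g h : ℝ → ℝ) :
    spectralMatrix hX g - spectralMatrix hX h = spectralMatrix hX (fun x => g x - h x) := by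
  simp [spectralMatrix, ← sub_mul, ← mul_sub]

lemma spectralMatrix_mul (g h : ℝ → ℝ) :
    spectralMatrix hX g * spectralMatrix hX h = spectralMatrix hX (fun x => g x * h x) := by
  have h1 : ∀ U D E : Matrix (Fin d) (Fin d) ℂ, Uᴴ * U = 1 →
      U * D * Uᴴ * (U * E * Uᴴ) = U * (D * E) * Uᴴ := by
    intro U D E hU
    calc U * D * Uᴴ * (U * E * Uᴴ) = U * D * (Uᴴ * U) * E * Uᴴ := by
          simp only [Matrix.mul_assoc]
      _ = _ := by rw [hU]; simp only [Matrix.mul_assoc, Matrix.one_mul]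
  rw [spectralMatrix, spectralMatrix, h1 _ _ _ (eigenvectorUnitary_conjTranspose_mul hX)]
  simp [spectralMatrix]

lemma spectralMatrix_posSemidef {g : ℝ → ℝ} (hg : ∀ x, 0 ≤ g x) :
    (spectralMatrix hX g).PosSemidef := by
  refine Matrix.PosSemidef.mul_mul_conjTranspose_same ?_ _
  rw [Matrix.posSemidef_diagonal_iff]
  intro i
  exact_mod_cast hg _

lemma trace_spectralMatrix (g : ℝ → ℝ) :
    (spectralMatrix hX g).trace = ((∑ i, g (hX.eigenvalues i) : ℝ) : ℂ) := by
  rw [spectralMatrix, Matrix.trace_mul_comm, ← Matrix.mul_assoc,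
    eigenvectorUnitary_conjTranspose_mul]
  simp [Matrix.trace]

lemma isHermitian_spectralMatrix (g : ℝ → ℝ) : (spectralMatrix hX g).IsHermitian := by
  refine Matrix.isHermitian_mul_mul_conjTranspose _ ?_
  rw [Matrix.isHermitian_diagonal_iff]
  intro i
  simp [IsSelfAdjoint]

end spectralMatrix

/-- With `R` the square root of `B`, cyclicity gives `tr(AB) = tr(R†AR)`, the trace of a positive
semidefinite matrix. -/
lemma Matrix.PosSemidef.re_trace_mul_nonneg {A B : Matrix (Fin d) (Fin d) ℂ}
    (hA : A.PosSemidef) (hB : B.PosSemidef) : 0 ≤ (A * B).trace.re := by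
  have hs : B = spectralMatrix hB.1 (fun x => √|x|) * (spectralMatrix hB.1 (fun x => √|x|))ᴴ := by
    rw [(isHermitian_spectralMatrix hB.1 _).eq, spectralMatrix_mul]
    conv_lhs => rw [← spectralMatrix_id hB.1]
    unfold spectralMatrix
    congr! 5 with i
    exact ((Real.mul_self_sqrt (abs_nonneg _)).trans (abs_of_nonneg (hB.eigenvalues_nonneg i))).symm
  rw [hs, ← Matrix.mul_assoc, Matrix.trace_mul_comm, ← Matrix.mul_assoc]
  have := (hA.conjTranspose_mul_mul_same (spectralMatrix hB.1 (fun x => √|x|))).trace_nonneg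
  exact (Complex.le_def.1 this).1

/-- `X†X` and the diagonal matrix of squared eigenvalues share a characteristic polynomial, so the
eigenvalues agree as multisets and no orderings need matching. -/
lemma traceNorm_eq_sum_abs {X : Matrix (Fin d) (Fin d) ℂ} (hX : X.IsHermitian) :
    traceNorm X = ∑ i, |hX.eigenvalues i| := by
  have hsq : Xᴴ * X = spectralMatrix hX (fun x => x ^ 2) := by
    conv_lhs => rw [hX.eq, ← spectralMatrix_id hX, spectralMatrix_mul]
    simp only [sq]
  have h1 : (Xᴴ * X).charpoly =
      (Matrix.diagonal (fun i => ((hX.eigenvalues i ^ 2 : ℝ) : ℂ))).charpoly := by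
    rw [hsq, spectralMatrix, Matrix.mul_assoc, Matrix.charpoly_mul_comm, Matrix.mul_assoc,
      eigenvectorUnitary_conjTranspose_mul, Matrix.mul_one]
  have h2 := (Matrix.isHermitian_conjTranspose_mul_self X).roots_charpoly_eq_eigenvalues
  rw [h1, Matrix.charpoly_diagonal, Polynomial.roots_prod _ _
    (Finset.prod_ne_zero_iff.2 fun i _ => Polynomial.X_sub_C_ne_zero _)] at h2
  simp only [Polynomial.roots_X_sub_C, Multiset.bind_singleton] at h2
  have h3 := congrArg (fun s => (s.map fun z : ℂ => √z.re).sum) h2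
  simp only [Multiset.map_map, Function.comp_def, Complex.ofReal_re] at h3
  rw [traceNorm_eq_sum_sqrt]
  refine Eq.trans h3.symm ?_
  change ∑ i, √(hX.eigenvalues i ^ 2) = _
  simp_rw [Real.sqrt_sq_eq_abs]

end TraceNorm

/-! ### Sign duality for the trace norm and dissipativity of Lindbladians. -/

noncomputable section Superoperators

open scoped Matrix ComplexOrder

variable {d : ℕ}

/-- `X = P - N` is the Jordan decomposition of a Hermitian matrix and `S` is its sign. -/
structure IsSignDecomposition (X S P N : Matrix (Fin d) (Fin d) ℂ) : Prop where
  posPart : P.PosSemidef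
  negPart : N.PosSemidef
  eq_sub : X = P - N
  sign_mul : S * X = P + N
  mul_sign : X * S = P + N
  sign_le : (1 - S).PosSemidef
  neg_le_sign : (1 + S).PosSemidef
  traceNorm_eq : traceNorm X = (P + N).trace.re

lemma Matrix.IsHermitian.exists_signDecomposition {X : Matrix (Fin d) (Fin d) ℂ}
    (hX : X.IsHermitian) : ∃ S P N, IsSignDecomposition X S P N := by
  have hs : ∀ x : ℝ, (SignType.sign x : ℝ) ≤ 1 ∧ -1 ≤ (SignType.sign x : ℝ) := by
    intro x
    rcases lt_trichotomy x 0 with h | h | h <;> simp [h]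
  have habs : ∀ x : ℝ, (SignType.sign x : ℝ) * x = max x 0 + max (-x) 0 := by
    intro x
    rcases lt_trichotomy x 0 with h | h | h
    · simp [h, h.le]
    · simp [h]
    · simp [h, h.le]
  have hsx : spectralMatrix hX (fun x => (SignType.sign x : ℝ)) * X =
      spectralMatrix hX (fun x => max x 0) + spectralMatrix hX (fun x => max (-x) 0) := by
    have h1 := spectralMatrix_mul hX (fun x => (SignType.sign x : ℝ)) (fun x => x)
    rw [spectralMatrix_id] at h1
    rw [h1, spectralMatrix_add]
    simp only [← habs]
  have hxs : X * spectralMatrix hX (fun x => (SignType.sign x : ℝ)) =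
      spectralMatrix hX (fun x => max x 0) + spectralMatrix hX (fun x => max (-x) 0) := by
    have h1 := spectralMatrix_mul hX (fun x => x) (fun x => (SignType.sign x : ℝ))
    rw [spectralMatrix_id] at h1
    rw [h1, spectralMatrix_add]
    simp only [← habs, mul_comm]
  refine ⟨spectralMatrix hX (fun x => (SignType.sign x : ℝ)), spectralMatrix hX (fun x => max x 0),
    spectralMatrix hX (fun x => max (-x) 0), ⟨?_, ?_, ?_, hsx, hxs, ?_, ?_, ?_⟩⟩
  · exact spectralMatrix_posSemidef hX fun x => le_max_right _ _
  · exact spectralMatrix_posSemidef hX fun x => le_max_right _ _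
  · rw [spectralMatrix_sub]
    conv_lhs => rw [← spectralMatrix_id hX]
    congr 1
    ext x
    rcases le_total x 0 with h | h <;> simp [h]
  · rw [← spectralMatrix_one hX, spectralMatrix_sub]
    exact spectralMatrix_posSemidef hX fun x => by linarith [(hs x).1]
  · rw [← spectralMatrix_one hX, spectralMatrix_add]
    exact spectralMatrix_posSemidef hX fun x => by linarith [(hs x).2]
  · rw [traceNorm_eq_sum_abs hX, spectralMatrix_add, trace_spectralMatrix, Complex.ofReal_re]
    refine Finset.sum_congr rfl fun i _ => ?_
    rcases le_total (hX.eigenvalues i) 0 with h | h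
    · simp [h, abs_of_nonpos h]
    · simp [h, abs_of_nonneg h]

/-- Pair `1 - S` with the positive part and `1 + S` with the negative part. Equality for the sign of
`X` makes the trace norm a maximum of linear functionals. -/
lemma Matrix.IsHermitian.re_trace_mul_le_traceNorm {X S : Matrix (Fin d) (Fin d) ℂ}
    (hX : X.IsHermitian) (h1 : (1 - S).PosSemidef) (h2 : (1 + S).PosSemidef) :
    (S * X).trace.re ≤ traceNorm X := by
  obtain ⟨S', P, N, h⟩ := hX.exists_signDecomposition
  have hP := h1.re_trace_mul_nonneg h.posPart
  have hN := h2.re_trace_mul_nonneg h.negPart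
  rw [h.traceNorm_eq]
  conv_lhs => rw [h.eq_sub]
  simp only [sub_mul, add_mul, mul_sub, one_mul, Matrix.trace_add, Matrix.trace_sub,
    Complex.add_re, Complex.sub_re] at *
  linarith

lemma IsSignDecomposition.re_trace_sign_mul {X S P N : Matrix (Fin d) (Fin d) ℂ}
    (h : IsSignDecomposition X S P N) : (S * X).trace.re = traceNorm X := by
  rw [h.sign_mul, h.traceNorm_eq]

lemma traceNorm_add_le {X Y : Matrix (Fin d) (Fin d) ℂ} (hX : X.IsHermitian)
    (hY : Y.IsHermitian) : traceNorm (X + Y) ≤ traceNorm X + traceNorm Y := by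
  obtain ⟨S, P, N, h⟩ := (hX.add hY).exists_signDecomposition
  rw [← h.re_trace_sign_mul, mul_add, Matrix.trace_add, Complex.add_re]
  exact add_le_add (hX.re_trace_mul_le_traceNorm h.sign_le h.neg_le_sign)
    (hY.re_trace_mul_le_traceNorm h.sign_le h.neg_le_sign)

lemma traceNorm_smul {X : Matrix (Fin d) (Fin d) ℂ} (hX : X.IsHermitian) {c : ℝ} (hc : 0 ≤ c) :
    traceNorm ((c : ℂ) • X) = c * traceNorm X := by
  have hcX : ((c : ℂ) • X).IsHermitian := by
    rw [Matrix.IsHermitian, Matrix.conjTranspose_smul, hX.eq]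
    simp
  have hre : ∀ S : Matrix (Fin d) (Fin d) ℂ,
      (S * ((c : ℂ) • X)).trace.re = c * (S * X).trace.re := by
    intro S
    simp [Matrix.trace_smul]
  apply le_antisymm
  · obtain ⟨S, P, N, h⟩ := hcX.exists_signDecomposition
    rw [← h.re_trace_sign_mul, hre]
    exact mul_le_mul_of_nonneg_left
      (hX.re_trace_mul_le_traceNorm h.sign_le h.neg_le_sign) hc
  · obtain ⟨S, P, N, h⟩ := hX.exists_signDecomposition
    rw [← h.re_trace_sign_mul, ← hre]
    exact hcX.re_trace_mul_le_traceNorm h.sign_le h.neg_le_sign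

lemma entryNorm_sub_comm (X Y : Matrix (Fin d) (Fin d) ℂ) :
    entryNorm (X - Y) = entryNorm (Y - X) := by
  simp [entryNorm, norm_sub_rev]

lemma abs_traceNorm_sub_le {X Y : Matrix (Fin d) (Fin d) ℂ} (hX : X.IsHermitian)
    (hY : Y.IsHermitian) : |traceNorm X - traceNorm Y| ≤ d * entryNorm (X - Y) := by
  have h1 := traceNorm_add_le hY (hX.sub hY)
  have h2 := traceNorm_add_le hX (hY.sub hX)
  rw [add_sub_cancel] at h1 h2
  have h3 := traceNorm_le_entryNorm (X - Y)
  have h4 := traceNorm_le_entryNorm (Y - X)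
  rw [entryNorm_sub_comm] at h4
  rw [abs_le]
  constructor <;> linarith

lemma eq_zero_of_traceNorm_le_zero {X : Matrix (Fin d) (Fin d) ℂ} (h : traceNorm X ≤ 0) :
    X = 0 := by
  have h0 : traceNorm X = 0 := le_antisymm h (traceNorm_nonneg X)
  ext i j
  have h1 := (norm_entry_le_entryNorm X i j).trans (entryNorm_le_traceNorm X)
  rw [h0, mul_zero] at h1
  exact norm_le_zero_iff.1 h1

lemma traceNorm_pos {X : Matrix (Fin d) (Fin d) ℂ} (h : X ≠ 0) : 0 < traceNorm X := by
  by_contra h'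
  exact h (eq_zero_of_traceNorm_le_zero (not_lt.1 h'))

@[simp] lemma traceNorm_zero : traceNorm (0 : Matrix (Fin d) (Fin d) ℂ) = 0 := by
  refine le_antisymm ((traceNorm_le_entryNorm 0).trans ?_) (traceNorm_nonneg _)
  simp [entryNorm]

/-- The sum of the absolute values of all entries of a superoperator. -/
def superopEntryNorm (T : Superoperator d) : ℝ :=
  ∑ k, ∑ l, entryNorm (T (Matrix.single k l 1))

lemma superopEntryNorm_nonneg (T : Superoperator d) : 0 ≤ superopEntryNorm T :=
  Finset.sum_nonneg fun _ _ => Finset.sum_nonneg fun _ _ => entryNorm_nonneg _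

lemma superop_apply_entry (T : Superoperator d) (X : Matrix (Fin d) (Fin d) ℂ) (i j : Fin d) :
    T X i j = ∑ k, ∑ l, X k l * T (Matrix.single k l 1) i j := by
  conv_lhs => rw [Matrix.matrix_eq_sum_single X]
  simp only [map_sum, Matrix.sum_apply]
  refine Finset.sum_congr rfl fun k _ => Finset.sum_congr rfl fun l _ => ?_
  have : Matrix.single k l (X k l) = X k l • Matrix.single k l (1 : ℂ) := by simp
  rw [this, map_smul, Matrix.smul_apply, smul_eq_mul]

lemma entryNorm_superop_apply_le (T : Superoperator d) (X : Matrix (Fin d) (Fin d) ℂ) :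
    entryNorm (T X) ≤ superopEntryNorm T * entryNorm X := by
  have h1 : ∀ i j, ‖T X i j‖ ≤ ∑ k, ∑ l, entryNorm X * ‖T (Matrix.single k l 1) i j‖ := by
    intro i j
    rw [superop_apply_entry]
    refine (norm_sum_le _ _).trans (Finset.sum_le_sum fun k _ => ?_)
    refine (norm_sum_le _ _).trans (Finset.sum_le_sum fun l _ => ?_)
    rw [norm_mul]
    exact mul_le_mul_of_nonneg_right (norm_entry_le_entryNorm X k l) (norm_nonneg _)
  calc entryNorm (T X) ≤ ∑ i, ∑ j, ∑ k, ∑ l, entryNorm X * ‖T (Matrix.single k l 1) i j‖ :=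
        Finset.sum_le_sum fun i _ => Finset.sum_le_sum fun j _ => h1 i j
    _ = ∑ k, ∑ l, ∑ i, ∑ j, entryNorm X * ‖T (Matrix.single k l 1) i j‖ := by
        have hc : ∀ f : Fin d → Fin d → Fin d → ℝ,
            ∑ i, ∑ j, ∑ k, f i j k = ∑ k, ∑ i, ∑ j, f i j k := by
          intro f
          rw [Finset.sum_congr rfl fun i _ => Finset.sum_comm (f := fun j k => f i j k),
            Finset.sum_comm]
        rw [hc]
        exact Finset.sum_congr rfl fun k _ => hc _
    _ = superopEntryNorm T * entryNorm X := by
        simp_rw [← Finset.mul_sum]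
        rw [mul_comm]
        rfl

lemma traceNorm_superop_apply_le (T : Superoperator d) (X : Matrix (Fin d) (Fin d) ℂ) :
    traceNorm (T X) ≤ superopNorm T * traceNorm X := by
  by_cases hX : X = 0
  · simp [hX]
  -- An unbounded real supremum would take the default value 0.
  have hbdd : BddAbove (range fun X : {X : Matrix (Fin d) (Fin d) ℂ // X ≠ 0} =>
      traceNorm (T X) / traceNorm X.1) := by
    refine ⟨d * (superopEntryNorm T * (d * d)), ?_⟩
    rintro _ ⟨Y, rfl⟩
    rw [div_le_iff₀ (traceNorm_pos Y.2)]
    calc traceNorm (T Y) ≤ d * entryNorm (T Y) := traceNorm_le_entryNorm _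
      _ ≤ d * (superopEntryNorm T * (d * d * traceNorm Y.1)) := by
        gcongr
        refine (entryNorm_superop_apply_le T Y).trans ?_
        exact mul_le_mul_of_nonneg_left (entryNorm_le_traceNorm _) (superopEntryNorm_nonneg T)
      _ = _ := by ring
  rw [← div_le_iff₀ (traceNorm_pos hX)]
  exact le_ciSup hbdd ⟨X, hX⟩

lemma superopNorm_nonneg (T : Superoperator d) : 0 ≤ superopNorm T :=
  Real.iSup_nonneg fun _ => div_nonneg (traceNorm_nonneg _) (traceNorm_nonneg _)

lemma IsLindbladian.trace_apply {T : Superoperator d} (hT : IsLindbladian T)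
    (X : Matrix (Fin d) (Fin d) ℂ) : (T X).trace = 0 := by
  obtain ⟨H, m, L, -, h⟩ := hT
  rw [h, Matrix.trace_add, Matrix.trace_smul, Matrix.trace_sub, Matrix.trace_mul_comm H X, sub_self,
    smul_zero, zero_add, Matrix.trace_sum]
  refine Finset.sum_eq_zero fun k _ => ?_
  rw [Matrix.trace_sub, Matrix.trace_smul, Matrix.trace_add, Matrix.trace_mul_comm X,
    Matrix.trace_mul_comm (L k * X), ← Matrix.mul_assoc]
  simp only [smul_eq_mul]
  ring

lemma IsLindbladian.isHermitian_apply {T : Superoperator d} (hT : IsLindbladian T)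
    {X : Matrix (Fin d) (Fin d) ℂ} (hX : X.IsHermitian) : (T X).IsHermitian := by
  obtain ⟨H, m, L, hH, h⟩ := hT
  rw [h, Matrix.IsHermitian, Matrix.conjTranspose_add, Matrix.conjTranspose_smul,
    Matrix.conjTranspose_sum]
  congr 1
  · rw [Matrix.conjTranspose_sub, Matrix.conjTranspose_mul, Matrix.conjTranspose_mul, hX.eq, hH.eq,
      ← neg_sub (H * X), smul_neg, ← neg_smul]
    simp
  · refine Finset.sum_congr rfl fun k _ => ?_
    simp only [Matrix.conjTranspose_sub, Matrix.conjTranspose_smul, Matrix.conjTranspose_add,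
      Matrix.conjTranspose_mul, Matrix.conjTranspose_conjTranspose, hX.eq, Matrix.mul_assoc]
    rw [add_comm]
    simp

/-- The Hamiltonian part drops out because `S` commutes with `X`. Since `SX = XS = P + N`, each jump
operator contributes `-tr(L†(1-S)L P) - tr(L†(1+S)L N)`, whose real part is nonpositive. -/
lemma IsSignDecomposition.re_trace_sign_mul_lindbladian_le {X S P N : Matrix (Fin d) (Fin d) ℂ}
    (hS : IsSignDecomposition X S P N) {T : Superoperator d} (hT : IsLindbladian T) :
    (S * T X).trace.re ≤ 0 := by
  obtain ⟨H, m, L, hH, h⟩ := hT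
  have hcomm : (S * (H * X - X * H)).trace = 0 := by
    rw [mul_sub, Matrix.trace_sub, ← Matrix.mul_assoc, ← Matrix.mul_assoc, hS.sign_mul,
      Matrix.trace_mul_comm (S * H), ← Matrix.mul_assoc, hS.mul_sign, sub_self]
  rw [h, mul_add, Matrix.trace_add, Matrix.mul_smul, Matrix.trace_smul, hcomm, smul_zero, zero_add,
    Finset.mul_sum, Matrix.trace_sum, Complex.re_sum]
  refine Finset.sum_nonpos fun k _ => ?_
  have h1 := (hS.sign_le.conjTranspose_mul_mul_same (L k)).re_trace_mul_nonneg hS.posPart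
  have h2 := (hS.neg_le_sign.conjTranspose_mul_mul_same (L k)).re_trace_mul_nonneg hS.negPart
  have e1 : (S * (L k * X * (L k)ᴴ)).trace = ((L k)ᴴ * S * L k * X).trace := by
    rw [← Matrix.mul_assoc, Matrix.trace_mul_comm]
    simp only [Matrix.mul_assoc]
  have e2 : (S * ((L k)ᴴ * L k * X)).trace = ((L k)ᴴ * L k * (P + N)).trace := by
    rw [← Matrix.mul_assoc, Matrix.trace_mul_comm, ← Matrix.mul_assoc, hS.mul_sign,
      Matrix.trace_mul_comm]
  have e3 : (S * (X * ((L k)ᴴ * L k))).trace = ((L k)ᴴ * L k * (P + N)).trace := by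
    rw [← Matrix.mul_assoc, hS.sign_mul, Matrix.trace_mul_comm]
  have e4 : (S * (L k * X * (L k)ᴴ - (1 / 2 : ℂ) • ((L k)ᴴ * L k * X + X * ((L k)ᴴ * L k)))).trace =
      ((L k)ᴴ * S * L k * X).trace - ((L k)ᴴ * L k * (P + N)).trace := by
    rw [mul_sub, Matrix.trace_sub, Matrix.mul_smul, Matrix.trace_smul, mul_add, Matrix.trace_add,
      e1, e2, e3, smul_eq_mul]
    ring
  rw [e4, hS.eq_sub]
  simp only [sub_mul, add_mul, mul_sub, mul_add, mul_one, Matrix.trace_add, Matrix.trace_sub,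
    Complex.add_re, Complex.sub_re] at h1 h2 ⊢
  linarith

end Superoperators

/-! ### Growth of the trace norm along absolutely continuous paths. -/

noncomputable section Growth

open scoped Matrix ComplexOrder

variable {d : ℕ}

lemma IntervalIntegrable.entryNorm {f : ℝ → Matrix (Fin d) (Fin d) ℂ} {s t : ℝ}
    (hf : ∀ i j, IntervalIntegrable (fun τ => f τ i j) volume s t) :
    IntervalIntegrable (fun τ => entryNorm (f τ)) volume s t := by
  have : (fun τ => _root_.entryNorm (f τ)) = ∑ i, ∑ j, fun τ => ‖f τ i j‖ := by
    ext τ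
    simp [_root_.entryNorm]
  rw [this]
  exact IntervalIntegrable.sum _ fun i _ => IntervalIntegrable.sum _ fun j _ => (hf i j).norm

/-- The trace norm is Lipschitz in the entries, so its increments are dominated by those of the
primitive of the integrable function `entryNorm (f τ)`. -/
lemma absolutelyContinuousOnInterval_traceNorm {w f : ℝ → Matrix (Fin d) (Fin d) ℂ} {s t : ℝ}
    (hst : s ≤ t) (hf : ∀ i j, IntervalIntegrable (fun τ => f τ i j) volume s t)
    (hw : ∀ r ∈ Icc s t, ∀ i j, w r i j = w s i j + ∫ τ in s..r, f τ i j)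
    (hherm : ∀ r ∈ Icc s t, (w r).IsHermitian) :
    AbsolutelyContinuousOnInterval (fun r => traceNorm (w r)) s t := by
  have hg := IntervalIntegrable.entryNorm hf
  have hsub : ∀ a ∈ Icc s t, ∀ b ∈ Icc s t, uIcc a b ⊆ uIcc s t := by
    intro a ha b hb
    rw [uIcc_of_le hst]
    exact uIcc_subset_Icc ha hb
  have hs : s ∈ Icc s t := left_mem_Icc.2 hst
  have hdist : ∀ a ∈ Icc s t, ∀ b ∈ Icc s t,
      dist (traceNorm (w a)) (traceNorm (w b)) ≤ d * (d * d) *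
        dist (∫ τ in s..a, entryNorm (f τ)) (∫ τ in s..b, entryNorm (f τ)) := by
    intro a ha b hb
    have hent : ∀ i j, ‖(w a - w b) i j‖ ≤
        dist (∫ τ in s..a, entryNorm (f τ)) (∫ τ in s..b, entryNorm (f τ)) := by
      intro i j
      rw [Matrix.sub_apply, hw a ha, hw b hb, add_sub_add_left_eq_sub,
        intervalIntegral.integral_interval_sub_left ((hf i j).mono_set (hsub _ hs _ ha))
          ((hf i j).mono_set (hsub _ hs _ hb)), Real.dist_eq,
        intervalIntegral.integral_interval_sub_left (hg.mono_set (hsub _ hs _ ha))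
          (hg.mono_set (hsub _ hs _ hb))]
      exact intervalIntegral.norm_integral_le_abs_of_norm_le
        (Filter.Eventually.of_forall fun τ => norm_entry_le_entryNorm _ i j)
        (hg.mono_set (hsub _ hb _ ha))
    rw [Real.dist_eq]
    refine (abs_traceNorm_sub_le (hherm a ha) (hherm b hb)).trans ?_
    rw [mul_assoc]
    refine mul_le_mul_of_nonneg_left ?_ (Nat.cast_nonneg _)
    calc entryNorm (w a - w b) ≤ ∑ _i : Fin d, ∑ _j : Fin d,
          dist (∫ τ in s..a, entryNorm (f τ)) (∫ τ in s..b, entryNorm (f τ)) :=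
        Finset.sum_le_sum fun i _ => Finset.sum_le_sum fun j _ => hent i j
      _ = _ := by simp [mul_assoc]
  have hG := (hg.absolutelyContinuousOnInterval_intervalIntegral
    (c := s) left_mem_uIcc).const_mul (d * (d * d))
  unfold AbsolutelyContinuousOnInterval at hG ⊢
  refine squeeze_zero' (Filter.Eventually.of_forall fun E =>
    Finset.sum_nonneg fun i _ => dist_nonneg) ?_ hG
  filter_upwards [Filter.mem_inf_of_right (Filter.mem_principal_self _)] with E hE
  refine Finset.sum_le_sum fun i hi => ?_
  have hmem := hE.1 i hi
  rw [uIcc_of_le hst] at hmem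
  refine (hdist _ hmem.1 _ hmem.2).trans (le_of_eq ?_)
  simp only [Real.dist_eq]
  rw [← mul_sub, abs_mul, abs_of_nonneg (by positivity : (0 : ℝ) ≤ d * (d * d))]

lemma hasDerivAt_re_trace_mul (S : Matrix (Fin d) (Fin d) ℂ) {W : ℝ → Matrix (Fin d) (Fin d) ℂ}
    {W' : Matrix (Fin d) (Fin d) ℂ} {x : ℝ}
    (h : ∀ i j, HasDerivAt (fun r => W r i j) (W' i j) x) :
    HasDerivAt (fun r => (S * W r).trace.re) (S * W').trace.re x := by
  have h1 : HasDerivAt (fun r => (S * W r).trace) (S * W').trace x := by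
    simp only [Matrix.trace, Matrix.diag, Matrix.mul_apply]
    exact HasDerivAt.fun_sum fun i _ => HasDerivAt.fun_sum fun j _ => (h j i).const_mul _
  exact Complex.reCLM.hasFDerivAt.comp_hasDerivAt x h1

/-- If an absolutely continuous Hermitian matrix function moves in a direction `f` that increases
its trace norm at rate at most `c` to first order, then the trace norm grows at rate at most
`c`. -/
lemma traceNorm_le_add_of_re_trace_le {w f : ℝ → Matrix (Fin d) (Fin d) ℂ} {s t c : ℝ}
    (hst : s ≤ t) (hf : ∀ i j, IntervalIntegrable (fun τ => f τ i j) volume s t)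
    (hw : ∀ r ∈ Icc s t, ∀ i j, w r i j = w s i j + ∫ τ in s..r, f τ i j)
    (hherm : ∀ r ∈ Icc s t, (w r).IsHermitian)
    (hdiss : ∀ r ∈ Ioo s t, ∃ S : Matrix (Fin d) (Fin d) ℂ, (1 - S).PosSemidef ∧
      (1 + S).PosSemidef ∧ (S * w r).trace.re = traceNorm (w r) ∧ (S * f r).trace.re ≤ c) :
    traceNorm (w t) ≤ traceNorm (w s) + c * (t - s) := by
  have hac := absolutelyContinuousOnInterval_traceNorm hst hf hw hherm
  have hderiv : ∀ᵐ x, x ∈ Icc s t → deriv (fun r => traceNorm (w r)) x ≤ c := by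
    have h1 : ∀ᵐ x, ∀ i j, x ∈ uIcc s t → ∀ c ∈ uIcc s t,
        HasDerivAt (fun x => ∫ τ in c..x, f τ i j) (f x i j) x :=
      ae_all_iff.2 fun i => ae_all_iff.2 fun j => (hf i j).ae_hasDerivAt_integral
    filter_upwards [hac.ae_differentiableAt, h1, Measure.ae_ne volume s, Measure.ae_ne volume t]
      with x hx1 hx2 hxs hxt hx
    rw [uIcc_of_le hst] at hx1 hx2
    have hx' : x ∈ Ioo s t := ⟨lt_of_le_of_ne hx.1 (Ne.symm hxs), lt_of_le_of_ne hx.2 hxt⟩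
    obtain ⟨S, hS1, hS2, hS3, hS4⟩ := hdiss x hx'
    have hwd : ∀ i j, HasDerivAt (fun r => w r i j) (f x i j) x := by
      intro i j
      refine ((hx2 i j hx s (left_mem_Icc.2 hst)).const_add (w s i j)).congr_of_eventuallyEq ?_
      filter_upwards [Ioo_mem_nhds hx'.1 hx'.2] with r hr
      exact hw r (Ioo_subset_Icc_self hr) i j
    have hψ := (hx1 hx).hasDerivAt.sub (hasDerivAt_re_trace_mul S hwd)
    -- The functional `Re tr(S ·)` lies below the trace norm and touches it at `w x`, so the two
    -- have the same derivative there.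
    have hmin : IsLocalMin ((fun r => traceNorm (w r)) - fun r => (S * w r).trace.re) x := by
      filter_upwards [Ioo_mem_nhds hx'.1 hx'.2] with r hr
      have := (hherm r (Ioo_subset_Icc_self hr)).re_trace_mul_le_traceNorm hS1 hS2
      simp only [Pi.sub_apply, hS3]
      linarith
    have := hmin.hasDerivAt_eq_zero hψ
    linarith
  have hint := hac.integral_deriv_eq_sub
  have hle : ∫ x in s..t, deriv (fun r => traceNorm (w r)) x ≤ ∫ _x in s..t, c := by
    refine intervalIntegral.integral_mono_ae_restrict hst hac.intervalIntegrable_deriv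
      intervalIntegrable_const ?_
    exact (ae_restrict_iff' measurableSet_Icc).2 hderiv
  rw [hint, intervalIntegral.integral_const, smul_eq_mul] at hle
  linarith

end Growth

/-! ### Convergence of the Dyson series and its integral equation. -/

noncomputable section Dyson

open scoped Matrix ComplexOrder

variable {d : ℕ}

/-- The power rule for a primitive that is only absolutely continuous; it supplies the factorials
bounding the Dyson terms. -/
lemma integral_mul_primitive_pow {a : ℝ → ℝ} {s t : ℝ} (ha : IntervalIntegrable a volume s t)
    (n : ℕ) :
    ∫ τ in s..t, a τ * (∫ x in s..τ, a x) ^ n = (∫ x in s..t, a x) ^ (n + 1) / (n + 1) := by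
  have hM : AbsolutelyContinuousOnInterval (fun τ => ∫ x in s..τ, a x) s t :=
    ha.absolutelyContinuousOnInterval_intervalIntegral left_mem_uIcc
  have hpow : ∀ n : ℕ,
      AbsolutelyContinuousOnInterval (fun τ => (∫ x in s..τ, a x) ^ (n + 1)) s t := by
    intro n
    induction n with
    | zero => simpa using hM
    | succ n ih =>
      have h := ih.fun_mul hM
      simp only [← pow_succ] at h
      exact h
  have h1 := (hpow n).integral_deriv_eq_sub
  have h2 : ∫ τ in s..t, deriv (fun τ => (∫ x in s..τ, a x) ^ (n + 1)) τ =
      ∫ τ in s..t, (n + 1) * (a τ * (∫ x in s..τ, a x) ^ n) := by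
    refine intervalIntegral.integral_congr_ae ?_
    filter_upwards [ha.ae_hasDerivAt_integral] with τ hτ hτ'
    rw [((hτ (uIoc_subset_uIcc hτ') s left_mem_uIcc).fun_pow (n + 1)).deriv]
    push_cast
    ring
  rw [h2, intervalIntegral.integral_const_mul] at h1
  rw [eq_div_iff (by positivity), mul_comm, h1]
  simp

namespace IsTimeDependentLindbladian

variable {𝓛 : ℝ → Superoperator d} (h𝓛 : IsTimeDependentLindbladian 𝓛)
include h𝓛

lemma intervalIntegrable_entry {s t : ℝ} (hs : 0 ≤ s) (ht : 0 ≤ t)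
    (X : Matrix (Fin d) (Fin d) ℂ) (i j : Fin d) :
    IntervalIntegrable (fun τ => 𝓛 τ X i j) volume s t := by
  refine IntegrableOn.intervalIntegrable ?_
  refine (h𝓛.locallyIntegrable X i j).integrableOn_compact_subset ?_ isCompact_uIcc
  intro x hx
  exact (le_min hs ht).trans hx.1

lemma intervalIntegrable_superopEntryNorm {s t : ℝ} (hs : 0 ≤ s) (ht : 0 ≤ t) :
    IntervalIntegrable (fun τ => superopEntryNorm (𝓛 τ)) volume s t := by
  have : (fun τ => superopEntryNorm (𝓛 τ)) =
      ∑ k, ∑ l, fun τ => entryNorm (𝓛 τ (Matrix.single k l 1)) := by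
    ext τ
    simp [superopEntryNorm]
  rw [this]
  exact IntervalIntegrable.sum _ fun k _ => IntervalIntegrable.sum _ fun l _ =>
    IntervalIntegrable.entryNorm fun i j => h𝓛.intervalIntegrable_entry hs ht _ i j

lemma intervalIntegrable_apply {s t : ℝ} (hs : 0 ≤ s) (ht : 0 ≤ t)
    {v : ℝ → Matrix (Fin d) (Fin d) ℂ}
    (hv : ∀ i j, ContinuousOn (fun τ => v τ i j) (uIcc s t)) (i j : Fin d) :
    IntervalIntegrable (fun τ => 𝓛 τ (v τ) i j) volume s t := by
  have : (fun τ => 𝓛 τ (v τ) i j) =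
      ∑ k, ∑ l, fun τ => v τ k l * 𝓛 τ (Matrix.single k l 1) i j := by
    ext τ
    simp only [Finset.sum_apply]
    exact superop_apply_entry _ _ _ _
  rw [this]
  exact IntervalIntegrable.sum _ fun k _ => IntervalIntegrable.sum _ fun l _ =>
    (h𝓛.intervalIntegrable_entry hs ht _ i j).continuousOn_mul (hv k l)

lemma continuousOn_dysonTerm {s t : ℝ} (hs : 0 ≤ s) (hst : s ≤ t) (X : Matrix (Fin d) (Fin d) ℂ)
    (n : ℕ) (i j : Fin d) : ContinuousOn (fun τ => dysonTerm 𝓛 s X n τ i j) (uIcc s t) := by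
  induction n generalizing i j with
  | zero => exact continuousOn_const
  | succ n ih =>
    exact intervalIntegral.continuousOn_primitive_interval'
      (h𝓛.intervalIntegrable_apply hs (hs.trans hst) ih i j) left_mem_uIcc

lemma intervalIntegrable_dysonTerm {s t : ℝ} (hs : 0 ≤ s) (hst : s ≤ t)
    (X : Matrix (Fin d) (Fin d) ℂ) (n : ℕ) (i j : Fin d) :
    IntervalIntegrable (fun τ => 𝓛 τ (dysonTerm 𝓛 s X n τ) i j) volume s t :=
  h𝓛.intervalIntegrable_apply hs (hs.trans hst) (h𝓛.continuousOn_dysonTerm hs hst X n) i j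

lemma entryNorm_dysonTerm_le {s t : ℝ} (hs : 0 ≤ s) (hst : s ≤ t) (X : Matrix (Fin d) (Fin d) ℂ)
    (n : ℕ) : entryNorm (dysonTerm 𝓛 s X n t) ≤
      (∫ τ in s..t, superopEntryNorm (𝓛 τ)) ^ n / n.factorial * entryNorm X := by
  induction n generalizing t with
  | zero => simp [dysonTerm]
  | succ n ih =>
    have ht := hs.trans hst
    have hint := h𝓛.intervalIntegrable_dysonTerm hs hst X n
    have ha := h𝓛.intervalIntegrable_superopEntryNorm hs ht
    have h1 : entryNorm (dysonTerm 𝓛 s X (n + 1) t) ≤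
        ∫ τ in s..t, entryNorm (𝓛 τ (dysonTerm 𝓛 s X n τ)) := by
      unfold entryNorm
      have hrow : ∀ i, IntervalIntegrable
          (fun τ => ∑ j, ‖𝓛 τ (dysonTerm 𝓛 s X n τ) i j‖) volume s t := by
        intro i
        simpa only [Finset.sum_fn] using IntervalIntegrable.sum Finset.univ
          (f := fun j τ => ‖𝓛 τ (dysonTerm 𝓛 s X n τ) i j‖) fun j _ => (hint i j).norm
      rw [intervalIntegral.integral_finsetSum fun i _ => hrow i]
      refine Finset.sum_le_sum fun i _ => ?_
      rw [intervalIntegral.integral_finsetSum fun j _ => (hint i j).norm]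
      exact Finset.sum_le_sum fun j _ => intervalIntegral.norm_integral_le_integral_norm hst
    have hcont : ContinuousOn (fun τ => (∫ x in s..τ, superopEntryNorm (𝓛 x)) ^ n) (uIcc s t) :=
      (intervalIntegral.continuousOn_primitive_interval' ha left_mem_uIcc).pow n
    have h2 : ∫ τ in s..t, entryNorm (𝓛 τ (dysonTerm 𝓛 s X n τ)) ≤
        ∫ τ in s..t, (entryNorm X / n.factorial) *
          (superopEntryNorm (𝓛 τ) * (∫ x in s..τ, superopEntryNorm (𝓛 x)) ^ n) := by
      refine intervalIntegral.integral_mono_on hst (IntervalIntegrable.entryNorm hint)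
        ((ha.mul_continuousOn hcont).const_mul _) fun τ hτ => ?_
      calc entryNorm (𝓛 τ (dysonTerm 𝓛 s X n τ))
          ≤ superopEntryNorm (𝓛 τ) * entryNorm (dysonTerm 𝓛 s X n τ) :=
            entryNorm_superop_apply_le _ _
        _ ≤ superopEntryNorm (𝓛 τ) * ((∫ x in s..τ, superopEntryNorm (𝓛 x)) ^ n /
              n.factorial * entryNorm X) :=
            mul_le_mul_of_nonneg_left (ih hτ.1) (superopEntryNorm_nonneg _)
        _ = _ := by ring
    rw [intervalIntegral.integral_const_mul, integral_mul_primitive_pow ha] at h2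
    refine (h1.trans h2).trans (le_of_eq ?_)
    rw [Nat.factorial_succ]
    push_cast
    field_simp

lemma isHermitian_dysonTerm {s t : ℝ} (hs : 0 ≤ s) (hst : s ≤ t) {X : Matrix (Fin d) (Fin d) ℂ}
    (hX : X.IsHermitian) (n : ℕ) : (dysonTerm 𝓛 s X n t).IsHermitian := by
  induction n generalizing t with
  | zero => exact hX
  | succ n ih =>
    ext i j
    simp only [dysonTerm, Matrix.conjTranspose_apply, Matrix.of_apply]
    rw [intervalIntegral.integral_of_le hst, intervalIntegral.integral_of_le hst, Complex.star_def,
      ← integral_conj]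
    refine setIntegral_congr_fun measurableSet_Ioc fun τ hτ => ?_
    exact ((h𝓛.isLindbladian τ (hs.trans hτ.1.le)).isHermitian_apply (ih hτ.1.le)).apply i j

lemma norm_dysonTerm_le {s r t : ℝ} (hs : 0 ≤ s) (hr : r ∈ Icc s t)
    (X : Matrix (Fin d) (Fin d) ℂ) (n : ℕ) (i j : Fin d) :
    ‖dysonTerm 𝓛 s X n r i j‖ ≤
      (∫ τ in s..t, superopEntryNorm (𝓛 τ)) ^ n / n.factorial * entryNorm X := by
  refine (norm_entry_le_entryNorm _ i j).trans
    ((h𝓛.entryNorm_dysonTerm_le hs hr.1 X n).trans ?_)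
  have hst := hr.1.trans hr.2
  have ha := h𝓛.intervalIntegrable_superopEntryNorm hs (hs.trans hst)
  have h0 : 0 ≤ ∫ τ in s..r, superopEntryNorm (𝓛 τ) :=
    intervalIntegral.integral_nonneg hr.1 fun τ _ => superopEntryNorm_nonneg _
  have h1 : ∫ τ in s..r, superopEntryNorm (𝓛 τ) ≤ ∫ τ in s..t, superopEntryNorm (𝓛 τ) :=
    intervalIntegral.integral_mono_interval le_rfl hr.1 hr.2
      (Filter.Eventually.of_forall fun τ => superopEntryNorm_nonneg _) ha
  have := entryNorm_nonneg X
  gcongr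

lemma hasSum_dysonTerm {s t : ℝ} (hs : 0 ≤ s) (hst : s ≤ t) (X : Matrix (Fin d) (Fin d) ℂ) :
    HasSum (fun n => dysonTerm 𝓛 s X n t) (timeEvolution 𝓛 t s X) := by
  refine Summable.hasSum ?_
  refine Pi.summable.2 fun i => Pi.summable.2 fun j => ?_
  exact Summable.of_norm_bounded
    ((Real.summable_pow_div_factorial (∫ τ in s..t, superopEntryNorm (𝓛 τ))).mul_right
      (entryNorm X))
    fun n => h𝓛.norm_dysonTerm_le hs (right_mem_Icc.2 hst) X n i j

lemma hasSum_dysonTerm_entry {s t : ℝ} (hs : 0 ≤ s) (hst : s ≤ t)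
    (X : Matrix (Fin d) (Fin d) ℂ) (i j : Fin d) :
    HasSum (fun n => dysonTerm 𝓛 s X n t i j) (timeEvolution 𝓛 t s X i j) :=
  Pi.hasSum.1 (Pi.hasSum.1 (h𝓛.hasSum_dysonTerm hs hst X) i) j

lemma continuousOn_timeEvolution {s t : ℝ} (hs : 0 ≤ s) (hst : s ≤ t)
    (X : Matrix (Fin d) (Fin d) ℂ) (i j : Fin d) :
    ContinuousOn (fun τ => timeEvolution 𝓛 τ s X i j) (uIcc s t) := by
  have h : ContinuousOn (fun τ => ∑' n, dysonTerm 𝓛 s X n τ i j) (uIcc s t) := by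
    refine continuousOn_tsum (fun n => h𝓛.continuousOn_dysonTerm hs hst X n i j)
      ((Real.summable_pow_div_factorial (∫ τ in s..t, superopEntryNorm (𝓛 τ))).mul_right
        (entryNorm X)) fun n τ hτ => ?_
    rw [uIcc_of_le hst] at hτ
    exact h𝓛.norm_dysonTerm_le hs hτ X n i j
  refine h.congr fun τ hτ => ?_
  rw [uIcc_of_le hst] at hτ
  exact (h𝓛.hasSum_dysonTerm_entry hs hτ.1 X i j).tsum_eq.symm

/-- Apply `𝓛` to the series and integrate termwise by dominated convergence; the integral of the
`n`-th term is Dyson term `n + 1`. -/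
lemma timeEvolution_eq_add_integral {s t : ℝ} (hs : 0 ≤ s) (hst : s ≤ t)
    (X : Matrix (Fin d) (Fin d) ℂ) (i j : Fin d) :
    timeEvolution 𝓛 t s X i j = X i j + ∫ τ in s..t, 𝓛 τ (timeEvolution 𝓛 τ s X) i j := by
  have hsum : HasSum (fun n => ∫ τ in s..t, 𝓛 τ (dysonTerm 𝓛 s X n τ) i j)
      (∫ τ in s..t, 𝓛 τ (timeEvolution 𝓛 τ s X) i j) := by
    refine intervalIntegral.hasSum_integral_of_dominated_convergence
      (fun n τ => superopEntryNorm (𝓛 τ) * (d * d *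
        ((∫ τ in s..t, superopEntryNorm (𝓛 τ)) ^ n / n.factorial * entryNorm X)))
      (fun n => (h𝓛.intervalIntegrable_dysonTerm hs hst X n i j).def'.aestronglyMeasurable)
      (fun n => Filter.Eventually.of_forall fun τ hτ => ?_)
      (Filter.Eventually.of_forall fun τ _ =>
        (((Real.summable_pow_div_factorial (∫ τ in s..t, superopEntryNorm (𝓛 τ))).mul_right
          (entryNorm X)).mul_left _).mul_left _)
      ?_ (Filter.Eventually.of_forall fun τ hτ => ?_)
    · rw [uIoc_of_le hst] at hτ
      refine (norm_entry_le_entryNorm _ i j).trans ((entryNorm_superop_apply_le _ _).trans ?_)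
      refine mul_le_mul_of_nonneg_left ?_ (superopEntryNorm_nonneg _)
      calc entryNorm (dysonTerm 𝓛 s X n τ) ≤ ∑ _i : Fin d, ∑ _j : Fin d,
            ((∫ τ in s..t, superopEntryNorm (𝓛 τ)) ^ n / n.factorial * entryNorm X) :=
          Finset.sum_le_sum fun i _ => Finset.sum_le_sum fun j _ =>
            h𝓛.norm_dysonTerm_le hs (Ioc_subset_Icc_self hτ) X n i j
        _ = _ := by simp [mul_assoc]
    · refine IntervalIntegrable.congr (fun τ _ => tsum_mul_left.symm) ?_
      exact (h𝓛.intervalIntegrable_superopEntryNorm hs (hs.trans hst)).mul_const _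
    · rw [uIoc_of_le hst] at hτ
      rw [superop_apply_entry]
      rw [funext fun n => superop_apply_entry (𝓛 τ) (dysonTerm 𝓛 s X n τ) i j]
      exact hasSum_sum fun k _ => hasSum_sum fun l _ =>
        (h𝓛.hasSum_dysonTerm_entry hs hτ.1.le X k l).mul_right _
  -- The shifted series lacks only its zeroth term, which is `X`.
  have h1 := (hasSum_nat_add_iff' 1).2 (h𝓛.hasSum_dysonTerm_entry hs hst X i j)
  have h2 := hsum.unique h1
  rw [h2]
  simp [dysonTerm]

lemma isHermitian_timeEvolution {s t : ℝ} (hs : 0 ≤ s) (hst : s ≤ t)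
    {X : Matrix (Fin d) (Fin d) ℂ} (hX : X.IsHermitian) :
    (timeEvolution 𝓛 t s X).IsHermitian := by
  ext i j
  have h1 := (h𝓛.hasSum_dysonTerm_entry hs hst X j i).star
  have h2 := h𝓛.hasSum_dysonTerm_entry hs hst X i j
  refine h1.unique ?_
  convert h2 using 2 with n
  exact (h𝓛.isHermitian_dysonTerm hs hst hX n).apply i j

end IsTimeDependentLindbladian

end Dyson

/-! ### Hermitian solutions of the evolution equation: comparison, uniqueness, contraction. -/

noncomputable section Evolution

open scoped Matrix ComplexOrder

variable {d : ℕ}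

lemma Matrix.IsHermitian.ofReal_smul {X : Matrix (Fin d) (Fin d) ℂ} (hX : X.IsHermitian) (c : ℝ) :
    ((c : ℂ) • X).IsHermitian := by
  rw [Matrix.IsHermitian, Matrix.conjTranspose_smul, hX.eq]
  simp

/-- `u` is a Hermitian solution of `u' = 𝓛 u` on `[s, ∞)`, in integral form. -/
structure IsHermitianEvolution (𝓛 : ℝ → Superoperator d) (s : ℝ)
    (u : ℝ → Matrix (Fin d) (Fin d) ℂ) : Prop where
  intervalIntegrable : ∀ t, s ≤ t → ∀ i j,
    IntervalIntegrable (fun τ => 𝓛 τ (u τ) i j) volume s t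
  eq_add_integral : ∀ t, s ≤ t → ∀ i j, u t i j = u s i j + ∫ τ in s..t, 𝓛 τ (u τ) i j
  isHermitian : ∀ t, s ≤ t → (u t).IsHermitian

lemma timeEvolution_self (𝓛 : ℝ → Superoperator d) (s : ℝ) (X : Matrix (Fin d) (Fin d) ℂ) :
    timeEvolution 𝓛 s s X = X := by
  unfold timeEvolution
  rw [tsum_eq_single 0]
  · rfl
  · intro n hn
    obtain ⟨m, rfl⟩ := Nat.exists_eq_succ_of_ne_zero hn
    ext i j
    simp [dysonTerm]

lemma IsTimeDependentLindbladian.isHermitianEvolution {𝓛 : ℝ → Superoperator d}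
    (h𝓛 : IsTimeDependentLindbladian 𝓛) {s : ℝ} (hs : 0 ≤ s) {X : Matrix (Fin d) (Fin d) ℂ}
    (hX : X.IsHermitian) : IsHermitianEvolution 𝓛 s (fun t => timeEvolution 𝓛 t s X) where
  intervalIntegrable t ht :=
    h𝓛.intervalIntegrable_apply hs (hs.trans ht) (h𝓛.continuousOn_timeEvolution hs ht X)
  eq_add_integral t ht i j := by
    simp only [timeEvolution_self]
    exact h𝓛.timeEvolution_eq_add_integral hs ht X i j
  isHermitian t ht := h𝓛.isHermitian_timeEvolution hs ht hX

namespace IsHermitianEvolution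

variable {𝓛 𝓛' : ℝ → Superoperator d} {s : ℝ} {u v : ℝ → Matrix (Fin d) (Fin d) ℂ}

/-- Changing the initial time of a solution takes the place of the composition law for
`timeEvolution`. -/
lemma restrict (hu : IsHermitianEvolution 𝓛 s u) {r : ℝ} (hsr : s ≤ r) :
    IsHermitianEvolution 𝓛 r u where
  intervalIntegrable t ht i j :=
    (hu.intervalIntegrable r hsr i j).symm.trans (hu.intervalIntegrable t (hsr.trans ht) i j)
  eq_add_integral t ht i j := by
    have h1 := hu.eq_add_integral t (hsr.trans ht) i j
    have h2 := hu.eq_add_integral r hsr i j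
    rw [h1, h2, add_assoc, intervalIntegral.integral_add_adjacent_intervals
      (hu.intervalIntegrable r hsr i j)
      ((hu.intervalIntegrable r hsr i j).symm.trans
        (hu.intervalIntegrable t (hsr.trans ht) i j))]
  isHermitian t ht := hu.isHermitian t (hsr.trans ht)

protected lemma zero : IsHermitianEvolution 𝓛 s (fun _ => 0) where
  intervalIntegrable t ht i j := by simp
  eq_add_integral t ht i j := by simp
  isHermitian t ht := Matrix.isHermitian_zero

lemma sub (hu : IsHermitianEvolution 𝓛 s u) (hv : IsHermitianEvolution 𝓛 s v) :
    IsHermitianEvolution 𝓛 s (fun t => u t - v t) where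
  intervalIntegrable t ht i j := by
    simpa only [map_sub, Matrix.sub_apply] using
      (hu.intervalIntegrable t ht i j).sub (hv.intervalIntegrable t ht i j)
  eq_add_integral t ht i j := by
    simp only [map_sub, Matrix.sub_apply]
    rw [intervalIntegral.integral_sub (hu.intervalIntegrable t ht i j)
      (hv.intervalIntegrable t ht i j), hu.eq_add_integral t ht i j, hv.eq_add_integral t ht i j]
    ring
  isHermitian t ht := (hu.isHermitian t ht).sub (hv.isHermitian t ht)

lemma smul (hu : IsHermitianEvolution 𝓛 s u) (c : ℝ) :
    IsHermitianEvolution 𝓛 s (fun t => (c : ℂ) • u t) where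
  intervalIntegrable t ht i j := by
    simpa only [map_smul, Matrix.smul_apply, smul_eq_mul] using
      (hu.intervalIntegrable t ht i j).const_mul (c : ℂ)
  eq_add_integral t ht i j := by
    simp only [map_smul, Matrix.smul_apply, smul_eq_mul]
    rw [intervalIntegral.integral_const_mul, hu.eq_add_integral t ht i j]
    ring
  isHermitian t ht := (hu.isHermitian t ht).ofReal_smul c

lemma trace_eq (hu : IsHermitianEvolution 𝓛 s u) (h𝓛 : IsTimeDependentLindbladian 𝓛)
    (hs : 0 ≤ s) {t : ℝ} (hst : s ≤ t) : (u t).trace = (u s).trace := by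
  have h1 : ∫ τ in s..t, ∑ i, 𝓛 τ (u τ) i i = 0 := by
    rw [intervalIntegral.integral_congr (g := fun _ => 0), intervalIntegral.integral_zero]
    intro τ hτ
    rw [uIcc_of_le hst] at hτ
    exact (h𝓛.isLindbladian τ (hs.trans hτ.1)).trace_apply _
  rw [intervalIntegral.integral_finsetSum fun i _ => hu.intervalIntegrable t hst i i] at h1
  simp only [Matrix.trace, Matrix.diag]
  rw [Finset.sum_congr rfl fun i _ => hu.eq_add_integral t hst i i, Finset.sum_add_distrib, h1,
    add_zero]

/-- The difference `w = v - u` solves `w' = 𝓛 w + (𝓛' - 𝓛) v`; by dissipativity only the second term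
can raise the trace norm. -/
lemma traceNorm_sub_le (hu : IsHermitianEvolution 𝓛 s u) (hv : IsHermitianEvolution 𝓛' s v)
    (h𝓛 : IsTimeDependentLindbladian 𝓛) (h𝓛' : IsTimeDependentLindbladian 𝓛') (hs : 0 ≤ s)
    {t c : ℝ} (hst : s ≤ t) (hc : ∀ τ, s ≤ τ → traceNorm ((𝓛' τ - 𝓛 τ) (v τ)) ≤ c) :
    traceNorm (v t - u t) ≤ traceNorm (v s - u s) + c * (t - s) := by
  refine traceNorm_le_add_of_re_trace_le (w := fun τ => v τ - u τ)
    (f := fun τ => 𝓛' τ (v τ) - 𝓛 τ (u τ)) hst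
    (fun i j => (hv.intervalIntegrable t hst i j).sub (hu.intervalIntegrable t hst i j))
    (fun r hr i j => ?_) (fun r hr => (hv.isHermitian r hr.1).sub (hu.isHermitian r hr.1))
    (fun r hr => ?_)
  · simp only [Matrix.sub_apply]
    rw [intervalIntegral.integral_sub (hv.intervalIntegrable r hr.1 i j)
      (hu.intervalIntegrable r hr.1 i j), hu.eq_add_integral r hr.1 i j,
      hv.eq_add_integral r hr.1 i j]
    ring
  · have hvr := hv.isHermitian r hr.1.le
    have h0r := hs.trans hr.1.le
    obtain ⟨S, P, N, hS⟩ := (hvr.sub (hu.isHermitian r hr.1.le)).exists_signDecomposition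
    refine ⟨S, hS.sign_le, hS.neg_le_sign, hS.re_trace_sign_mul, ?_⟩
    have hsplit : 𝓛' r (v r) - 𝓛 r (u r) = 𝓛 r (v r - u r) + (𝓛' r - 𝓛 r) (v r) := by
      rw [map_sub, LinearMap.sub_apply]
      abel
    have hherm : ((𝓛' r - 𝓛 r) (v r)).IsHermitian :=
      ((h𝓛'.isLindbladian r h0r).isHermitian_apply hvr).sub
        ((h𝓛.isLindbladian r h0r).isHermitian_apply hvr)
    have h1 := hS.re_trace_sign_mul_lindbladian_le (h𝓛.isLindbladian r h0r)
    have h2 := hherm.re_trace_mul_le_traceNorm hS.sign_le hS.neg_le_sign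
    have h3 := hc r hr.1.le
    rw [hsplit, mul_add, Matrix.trace_add, Complex.add_re]
    linarith

lemma traceNorm_le (hu : IsHermitianEvolution 𝓛 s u) (h𝓛 : IsTimeDependentLindbladian 𝓛)
    (hs : 0 ≤ s) {t : ℝ} (hst : s ≤ t) : traceNorm (u t) ≤ traceNorm (u s) := by
  have := IsHermitianEvolution.zero.traceNorm_sub_le hu h𝓛 h𝓛 hs hst (c := 0) (by simp)
  simpa using this

lemma eq_of_eq (hu : IsHermitianEvolution 𝓛 s u) (hv : IsHermitianEvolution 𝓛 s v)
    (h𝓛 : IsTimeDependentLindbladian 𝓛) (hs : 0 ≤ s) (h : u s = v s) {t : ℝ} (hst : s ≤ t) :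
    u t = v t := by
  have := (hu.sub hv).traceNorm_le h𝓛 hs hst
  simp only [h, sub_self, traceNorm_zero] at this
  exact sub_eq_zero.1 (eq_zero_of_traceNorm_le_zero this)

/-- A traceless Hermitian matrix is a multiple of a difference of density matrices: its positive and
negative parts have equal trace `c`. The case `c = 0` forces `u s = 0`. -/
lemma traceNorm_le_of_isExpContractiveWith (hu : IsHermitianEvolution 𝓛 s u)
    (h𝓛 : IsTimeDependentLindbladian 𝓛) (hs : 0 ≤ s) {K γ : ℝ}
    (hcontr : IsExpContractiveWith 𝓛 K γ) (htr : (u s).trace = 0) {t : ℝ} (hst : s ≤ t) :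
    traceNorm (u t) ≤ K * Real.exp (-γ * (t - s)) * traceNorm (u s) := by
  obtain ⟨S, P, N, h⟩ := (hu.isHermitian s le_rfl).exists_signDecomposition
  have htrPN : P.trace = N.trace := by
    rw [h.eq_sub, Matrix.trace_sub] at htr
    exact sub_eq_zero.1 htr
  have hP := h.posPart.trace_nonneg
  obtain ⟨c, hc⟩ : ∃ c : ℝ, P.trace = c :=
    ⟨P.trace.re, (Complex.eq_re_of_ofReal_le (r := 0) (by simpa using hP))⟩
  rw [hc] at hP
  have hc0 : 0 ≤ c := by exact_mod_cast hP
  rcases hc0.eq_or_lt with hc0 | hc0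
  · have hP0 : P = 0 := h.posPart.trace_eq_zero_iff.1 (by simp [hc, ← hc0])
    have hN0 : N = 0 := h.negPart.trace_eq_zero_iff.1 (by simp [← htrPN, hc, ← hc0])
    have hus : u s = 0 := by rw [h.eq_sub, hP0, hN0, sub_zero]
    have := hu.traceNorm_le h𝓛 hs hst
    simpa [hus] using this
  have hcc : (c : ℂ) ≠ 0 := by exact_mod_cast hc0.ne'
  have hdens : ∀ Q : Matrix (Fin d) (Fin d) ℂ, Q.PosSemidef → Q.trace = c →
      IsDensityMatrix (((c⁻¹ : ℝ) : ℂ) • Q) := by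
    intro Q hQ hQc
    refine ⟨hQ.smul (by exact_mod_cast (inv_pos.2 hc0).le), ?_⟩
    rw [Matrix.trace_smul, hQc, smul_eq_mul]
    push_cast
    exact inv_mul_cancel₀ hcc
  have hρ := hdens P h.posPart hc
  have hσ := hdens N h.negPart (htrPN ▸ hc)
  have hle := hcontr.2.2 _ _ hρ hσ s t hs hst
  have hsub : ((c⁻¹ : ℝ) : ℂ) • P - ((c⁻¹ : ℝ) : ℂ) • N = ((c⁻¹ : ℝ) : ℂ) • u s := by
    rw [← smul_sub, ← h.eq_sub]
  rw [hsub, traceNorm_smul (hu.isHermitian s le_rfl) (inv_pos.2 hc0).le,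
    abs_of_nonneg (sub_nonneg.2 hst)] at hle
  have hev := h𝓛.isHermitianEvolution hs ((hu.isHermitian s le_rfl).ofReal_smul c⁻¹)
  -- Uniqueness identifies the rescaled solution with the Dyson series, to which the hypothesis
  -- refers.
  have heq := (hu.smul c⁻¹).eq_of_eq hev h𝓛 hs (timeEvolution_self _ _ _).symm hst
  rw [← heq, traceNorm_smul (hu.isHermitian t hst) (inv_pos.2 hc0).le] at hle
  refine le_of_mul_le_mul_left (hle.trans (le_of_eq ?_)) (inv_pos.2 hc0)
  ring

end IsHermitianEvolution

end Evolution

/-! ### A discrete Duhamel estimate and its iteration. -/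

noncomputable section Perturbation

open scoped Matrix ComplexOrder

variable {d : ℕ}

/-- Summation of infinitesimal bounds `φ (b) - φ (a) ≤ C exp (γ b) (b - a)`. -/
lemma le_add_exp_of_forall_le {φ : ℝ → ℝ} {C γ s q : ℝ} (hγ : 0 < γ) (hC : 0 ≤ C) (hsq : s ≤ q)
    (h : ∀ a b, s ≤ a → a ≤ b → b ≤ q → φ b ≤ φ a + C * Real.exp (γ * b) * (b - a)) :
    φ q ≤ φ s + C / γ * (Real.exp (γ * q) - Real.exp (γ * s)) := by
  have step : ∀ a b, s ≤ a → a ≤ b → b ≤ q → φ b ≤ φ a +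
      Real.exp (γ * (b - a)) * (C / γ) * (Real.exp (γ * b) - Real.exp (γ * a)) := by
    intro a b ha hab hb
    refine (h a b ha hab hb).trans (add_le_add_right ?_ _)
    have h1 : γ * (b - a) * Real.exp (γ * a) ≤ Real.exp (γ * b) - Real.exp (γ * a) := by
      have h2 : Real.exp (γ * b) = Real.exp (γ * (b - a)) * Real.exp (γ * a) := by
        rw [← Real.exp_add]; ring_nf
      have h3 := Real.add_one_le_exp (γ * (b - a))
      rw [h2]
      nlinarith [Real.exp_pos (γ * a)]
    have h2 : Real.exp (γ * b) = Real.exp (γ * (b - a)) * Real.exp (γ * a) := by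
      rw [← Real.exp_add]; ring_nf
    calc C * Real.exp (γ * b) * (b - a) =
          Real.exp (γ * (b - a)) * (C / γ) * (γ * (b - a) * Real.exp (γ * a)) := by
          rw [h2]; field_simp
      _ ≤ _ := mul_le_mul_of_nonneg_left h1 (by positivity)
  -- Telescoping over a partition of mesh `η`: evaluating the exponential at right endpoints costs
  -- the factor `exp(γη)`, which tends to 1 with the mesh.
  have sum : ∀ η : ℝ, 0 ≤ η → ∀ k : ℕ, s + k * η ≤ q → φ (s + k * η) ≤ φ s +
      Real.exp (γ * η) * (C / γ) * (Real.exp (γ * (s + k * η)) - Real.exp (γ * s)) := by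
    intro η hη k
    induction k with
    | zero => simp
    | succ k ih =>
      intro hk
      have hk0 : 0 ≤ k * η := by positivity
      push_cast at hk ⊢
      have h1 := ih (by linarith)
      have h2 := step (s + k * η) (s + (k + 1) * η) (by linarith) (by linarith) hk
      rw [show s + (k + 1) * η - (s + k * η) = η by ring] at h2
      linarith
  have hlim : Filter.Tendsto (fun n : ℕ => φ s + Real.exp (γ * ((q - s) / ((n : ℝ) + 1))) *
      (C / γ) * (Real.exp (γ * q) - Real.exp (γ * s))) Filter.atTop
      (nhds (φ s + Real.exp (γ * 0) * (C / γ) * (Real.exp (γ * q) - Real.exp (γ * s)))) := by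
    refine Filter.Tendsto.const_add _ (Filter.Tendsto.mul_const _ (Filter.Tendsto.mul_const _ ?_))
    refine (Real.continuous_exp.tendsto _).comp (Filter.Tendsto.const_mul _ ?_)
    have := (tendsto_one_div_add_atTop_nhds_zero_nat (𝕜 := ℝ)).const_mul (q - s)
    simpa [div_eq_mul_inv] using this
  have hge := ge_of_tendsto' (b := φ q) hlim fun n => by
    have hn : s + ((n + 1 : ℕ) : ℝ) * ((q - s) / ((n : ℝ) + 1)) = q := by
      push_cast
      field_simp
      ring
    have := sum ((q - s) / ((n : ℝ) + 1)) (div_nonneg (by linarith) (by positivity)) (n + 1) hn.le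
    rwa [hn] at this
  simpa using hge

variable {𝓛 𝓛' : ℝ → Superoperator d} {K γ Δ : ℝ} {s t : ℝ} {y : ℝ → Matrix (Fin d) (Fin d) ℂ}

/-- Comparison of evolving with `𝓛'` until time `b`, then with `𝓛`, to switching at time `a`. -/
lemma traceNorm_timeEvolution_switch_le (h𝓛 : IsTimeDependentLindbladian 𝓛)
    (h𝓛' : IsTimeDependentLindbladian 𝓛') (hcontr : IsExpContractiveWith 𝓛 K γ) (hΔ0 : 0 ≤ Δ)
    (hΔ : ∀ τ, 0 ≤ τ → ∀ X, traceNorm ((𝓛' τ - 𝓛 τ) X) ≤ Δ * traceNorm X)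
    (hs : 0 ≤ s) (hy : IsHermitianEvolution 𝓛' s y)
    {a b : ℝ} (hsa : s ≤ a) (hab : a ≤ b) (hbt : b ≤ t) :
    traceNorm (timeEvolution 𝓛 t b (y b)) ≤ traceNorm (timeEvolution 𝓛 t a (y a)) +
      min 1 (K * Real.exp (-γ * (t - b))) * (Δ * traceNorm (y s) * (b - a)) := by
  have ha0 := hs.trans hsa
  have hb0 := ha0.trans hab
  have hsb := hsa.trans hab
  have hub := h𝓛.isHermitianEvolution hb0 (hy.isHermitian b hsb)
  have hua := h𝓛.isHermitianEvolution ha0 (hy.isHermitian a hsa)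
  have hdiff := hub.sub (hua.restrict hab)
  -- Both trajectories agree at time `a`, and `y` has not grown in trace norm since time `s`.
  have hstart : traceNorm (y b - timeEvolution 𝓛 b a (y a)) ≤ Δ * traceNorm (y s) * (b - a) := by
    have h1 := hua.traceNorm_sub_le (hy.restrict hsa) h𝓛 h𝓛' ha0 hab
      (c := Δ * traceNorm (y s)) fun τ hτ => (hΔ τ (ha0.trans hτ) _).trans
        (mul_le_mul_of_nonneg_left (hy.traceNorm_le h𝓛' hs (hsa.trans hτ)) hΔ0)
    simpa [timeEvolution_self] using h1
  -- Both evolutions preserve the trace, so the contractivity of `𝓛` applies to their difference.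
  have htrace : (timeEvolution 𝓛 b b (y b) - timeEvolution 𝓛 b a (y a)).trace = 0 := by
    have h1 := hua.trace_eq h𝓛 ha0 hab
    simp only [timeEvolution_self] at h1 ⊢
    rw [Matrix.trace_sub, h1, hy.trace_eq h𝓛' hs hsb, hy.trace_eq h𝓛' hs hsa, sub_self]
  have h1 := hdiff.traceNorm_le h𝓛 hb0 hbt
  have h2 := hdiff.traceNorm_le_of_isExpContractiveWith h𝓛 hb0 hcontr htrace hbt
  simp only [timeEvolution_self] at h1 h2
  have h3 : traceNorm (timeEvolution 𝓛 t b (y b) - timeEvolution 𝓛 t a (y a)) ≤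
      min 1 (K * Real.exp (-γ * (t - b))) * (Δ * traceNorm (y s) * (b - a)) := by
    refine le_trans ?_ (mul_le_mul_of_nonneg_left hstart
      (le_min zero_le_one (mul_nonneg hcontr.1.le (Real.exp_pos _).le)))
    rcases min_choice 1 (K * Real.exp (-γ * (t - b))) with h | h <;> rw [h]
    · rwa [one_mul]
    · exact h2
  have h4 := traceNorm_add_le (hua.isHermitian t (hab.trans hbt)) (hdiff.isHermitian t hbt)
  rw [add_sub_cancel] at h4
  linarith

lemma traceNorm_perturbed_le (h𝓛 : IsTimeDependentLindbladian 𝓛)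
    (h𝓛' : IsTimeDependentLindbladian 𝓛') (hcontr : IsExpContractiveWith 𝓛 K γ) (hΔ0 : 0 ≤ Δ)
    (hΔ : ∀ τ, 0 ≤ τ → ∀ X, traceNorm ((𝓛' τ - 𝓛 τ) X) ≤ Δ * traceNorm X)
    (hK : 1 ≤ K) (hs : 0 ≤ s) (hy : IsHermitianEvolution 𝓛' s y) (htr : (y s).trace = 0)
    (hst : Real.log K ≤ γ * (t - s)) :
    traceNorm (y t) ≤ ((1 + Real.log K) / γ * Δ + K * (1 - Δ / γ) * Real.exp (-(γ * (t - s)))) *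
      traceNorm (y s) := by
  have hγ := hcontr.2.1
  have hK0 := hcontr.1
  have hlog := Real.log_nonneg hK
  -- At `q` one has `K exp(-γ(t-q)) = 1`, so the minimum in the switching bound changes branch
  -- there.
  set q := t - Real.log K / γ with hq
  have hsq : s ≤ q := by
    have : Real.log K / γ ≤ t - s := by rwa [div_le_iff₀' hγ]
    linarith
  have hqt : q ≤ t := by
    have : 0 ≤ Real.log K / γ := by positivity
    linarith
  have hN := traceNorm_nonneg (y s)
  have h1 := le_add_exp_of_forall_le (φ := fun τ => traceNorm (timeEvolution 𝓛 t τ (y τ)))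
    (C := K * Real.exp (-(γ * t)) * (Δ * traceNorm (y s))) hγ (by positivity) hsq
    fun a b ha hab hb => by
      refine (traceNorm_timeEvolution_switch_le h𝓛 h𝓛' hcontr hΔ0 hΔ hs hy ha hab
        (hb.trans hqt)).trans (add_le_add_right ?_ _)
      have hab' : 0 ≤ Δ * traceNorm (y s) * (b - a) := mul_nonneg (by positivity) (by linarith)
      refine (mul_le_mul_of_nonneg_right (min_le_right _ _) hab').trans (le_of_eq ?_)
      rw [show -γ * (t - b) = -(γ * t) + γ * b by ring, Real.exp_add]
      ring
  -- On `[q, t]` a single switch suffices, as the bound 1 does not depend on the time.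
  have h2 := traceNorm_timeEvolution_switch_le h𝓛 h𝓛' hcontr hΔ0 hΔ hs hy hsq hqt le_rfl
  have hqt' : 0 ≤ Δ * traceNorm (y s) * (t - q) := mul_nonneg (by positivity) (by linarith)
  have h3 := mul_le_mul_of_nonneg_right (min_le_left 1 (K * Real.exp (-γ * (t - t)))) hqt'
  have h4 := (h𝓛.isHermitianEvolution hs
    (hy.isHermitian s le_rfl)).traceNorm_le_of_isExpContractiveWith h𝓛 hs hcontr
    (by simpa [timeEvolution_self] using htr) (hsq.trans hqt)
  simp only [timeEvolution_self] at h1 h2 h4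
  have e1 : Real.exp (-(γ * t)) * Real.exp (γ * q) = K⁻¹ := by
    rw [← Real.exp_add, hq, show -(γ * t) + γ * (t - Real.log K / γ) = -Real.log K by
      field_simp; ring, Real.exp_neg, Real.exp_log hK0]
  have e2 : Real.exp (-(γ * t)) * Real.exp (γ * s) = Real.exp (-(γ * (t - s))) := by
    rw [← Real.exp_add]; ring_nf
  have e3 : K * Real.exp (-(γ * t)) * (Δ * traceNorm (y s)) / γ *
      (Real.exp (γ * q) - Real.exp (γ * s)) =
      (Δ * traceNorm (y s)) / γ * (1 - K * Real.exp (-(γ * (t - s)))) := by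
    rw [← e2, ← mul_inv_cancel₀ hK0.ne', ← e1]
    ring
  have e4 : t - q = Real.log K / γ := by rw [hq]; ring
  rw [e3] at h1
  rw [e4] at h2 h3
  rw [neg_mul] at h4
  calc traceNorm (y t) ≤ K * Real.exp (-(γ * (t - s))) * traceNorm (y s) +
        (Δ * traceNorm (y s)) / γ * (1 - K * Real.exp (-(γ * (t - s)))) +
        1 * (Δ * traceNorm (y s) * (Real.log K / γ)) := by linarith
    _ = _ := by field_simp; ring

/-- Whole steps contract by `exp(-rx)` each. In the last incomplete step the trace norm does not
grow, and the prefactor `exp(rx)` makes up for the missing decay. -/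
lemma traceNorm_le_exp_mul_of_step {r x : ℝ} (h𝓛' : IsTimeDependentLindbladian 𝓛') (hx : 0 < x)
    (hr : 0 ≤ r)
    (hstep : ∀ s, 0 ≤ s → ∀ y, IsHermitianEvolution 𝓛' s y → (y s).trace = 0 →
      traceNorm (y (s + x)) ≤ Real.exp (-(r * x)) * traceNorm (y s))
    (hs : 0 ≤ s) (hy : IsHermitianEvolution 𝓛' s y) (htr : (y s).trace = 0) (hst : s ≤ t) :
    traceNorm (y t) ≤ Real.exp (r * x) * Real.exp (-r * (t - s)) * traceNorm (y s) := by
  have hiter : ∀ n : ℕ,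
      traceNorm (y (s + n * x)) ≤ Real.exp (-(r * (n * x))) * traceNorm (y s) := by
    intro n
    induction n with
    | zero => simp
    | succ n ih =>
      have hn : s ≤ s + n * x := le_add_of_nonneg_right (by positivity)
      have h1 := hstep (s + n * x) (hs.trans hn) y (hy.restrict hn)
        ((hy.trace_eq h𝓛' hs hn).trans htr)
      have h2 := h1.trans (mul_le_mul_of_nonneg_left ih (Real.exp_pos _).le)
      rw [← mul_assoc, ← Real.exp_add] at h2
      have e1 : s + (n + 1 : ℕ) * x = s + n * x + x := by push_cast; ring
      have e2 : -(r * ((n + 1 : ℕ) * x)) = -(r * x) + -(r * (n * x)) := by push_cast; ring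
      rwa [e1, e2]
  set n := ⌊(t - s) / x⌋₊
  have hn1 : n * x ≤ t - s := by
    rw [← le_div_iff₀ hx]
    exact Nat.floor_le (div_nonneg (by linarith) hx.le)
  have hn2 : t - s ≤ (n + 1) * x := by
    rw [← div_le_iff₀ hx]
    exact (Nat.lt_floor_add_one _).le
  have hn0 : s ≤ s + n * x := le_add_of_nonneg_right (by positivity)
  have h1 := (hy.restrict hn0).traceNorm_le h𝓛' (hs.trans hn0) (t := t) (by linarith)
  refine (h1.trans (hiter n)).trans (mul_le_mul_of_nonneg_right ?_ (traceNorm_nonneg _))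
  rw [← Real.exp_add, Real.exp_le_exp]
  nlinarith

end Perturbation

/-! ### Calculus of the rate function. -/

section PerturbedRate

open Filter Topology

variable {K γ Δ x y : ℝ}

lemma perturbedRate_arg_pos (hK : 1 ≤ K) (hγ : 0 < γ) (hΔ0 : 0 ≤ Δ) (hΔγ : Δ < γ) (x : ℝ) :
    0 < (1 + Real.log K) / γ * Δ + K * (1 - Δ / γ) * Real.exp (-x) := by
  have h1 := Real.log_nonneg hK
  have h2 : 0 < 1 - Δ / γ := by rw [sub_pos, div_lt_one hγ]; exact hΔγ
  positivity

lemma exp_neg_perturbedRate_mul (hK : 1 ≤ K) (hγ : 0 < γ) (hΔ0 : 0 ≤ Δ) (hΔγ : Δ < γ)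
    (hx : 0 < x) : Real.exp (-(perturbedRate K γ Δ x * (x / γ))) =
      (1 + Real.log K) / γ * Δ + K * (1 - Δ / γ) * Real.exp (-x) := by
  have h1 : -(perturbedRate K γ Δ x * (x / γ)) =
      Real.log ((1 + Real.log K) / γ * Δ + K * (1 - Δ / γ) * Real.exp (-x)) := by
    unfold perturbedRate
    field_simp
  rw [h1, Real.exp_log (perturbedRate_arg_pos hK hγ hΔ0 hΔγ x)]

/-- For these `x` one has `K e^{-x} ≥ 1`, so the logarithm's argument is at least a convex
combination of 1 and `K e^{-x}`. Hence a positive rate forces `ln K < x`, and the block is long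
enough for `traceNorm_perturbed_le`. -/
lemma perturbedRate_nonpos_of_le_log (hK : 1 ≤ K) (hγ : 0 < γ) (hΔ0 : 0 ≤ Δ) (hΔγ : Δ < γ)
    (hx : 0 < x) (hxK : x ≤ Real.log K) : perturbedRate K γ Δ x ≤ 0 := by
  have h1 := Real.log_nonneg hK
  have h2 : 0 < 1 - Δ / γ := by rw [sub_pos, div_lt_one hγ]; exact hΔγ
  have h3 : 1 ≤ K * Real.exp (-x) := by
    rw [Real.exp_neg, ← div_eq_mul_inv, one_le_div (Real.exp_pos _)]
    exact (Real.le_log_iff_exp_le (by linarith)).1 hxK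
  have h4 : 1 ≤ (1 + Real.log K) / γ * Δ + K * (1 - Δ / γ) * Real.exp (-x) := by
    have : 0 ≤ Real.log K * (Δ / γ) := by positivity
    have e : (1 + Real.log K) / γ * Δ + K * (1 - Δ / γ) * Real.exp (-x) =
        Δ / γ + Real.log K * (Δ / γ) + (1 - Δ / γ) * (K * Real.exp (-x)) := by ring
    rw [e]
    nlinarith
  have h5 := Real.log_nonneg h4
  unfold perturbedRate
  rw [neg_mul, neg_nonpos]
  positivity

/-- If `x` and `y` both attain the maximum `m`, then `exp(-mz/γ) ≤ b + c e^{-z}` with equality at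
`x` and `y`. At the midpoint, with `u = e^{-x/2}` and `v = e^{-y/2}`, this reads `(b + cu²)(b + cv²)
≤ (b + cuv)²`, contradicting the Cauchy–Schwarz gap `bc(u - v)² > 0`. -/
lemma perturbedRate_lt_of_isMaxOn (hK : 1 ≤ K) (hγ : 0 < γ) (hΔ : 0 < Δ) (hΔγ : Δ < γ)
    (hx : 0 < x) (hmax : ∀ y, 0 < y → perturbedRate K γ Δ y ≤ perturbedRate K γ Δ x)
    (hy : 0 < y) (hyx : y ≠ x) : perturbedRate K γ Δ y < perturbedRate K γ Δ x := by
  refine lt_of_le_of_ne (hmax y hy) fun heq => ?_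
  have hz : 0 < (x + y) / 2 := by positivity
  have ex := exp_neg_perturbedRate_mul hK hγ hΔ.le hΔγ hx
  have ey := exp_neg_perturbedRate_mul hK hγ hΔ.le hΔγ hy
  have ez := exp_neg_perturbedRate_mul hK hγ hΔ.le hΔγ hz
  rw [heq] at ey
  set m := perturbedRate K γ Δ x
  have hb : 0 < (1 + Real.log K) / γ * Δ := by
    have := Real.log_nonneg hK
    positivity
  have hc : 0 < K * (1 - Δ / γ) := by
    have : 0 < 1 - Δ / γ := by rw [sub_pos, div_lt_one hγ]; exact hΔγ
    positivity
  have hge : Real.exp (-(m * ((x + y) / 2 / γ))) ≤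
      (1 + Real.log K) / γ * Δ + K * (1 - Δ / γ) * Real.exp (-((x + y) / 2)) := by
    rw [← ez, Real.exp_le_exp, neg_le_neg_iff]
    exact mul_le_mul_of_nonneg_right (hmax _ hz) (by positivity)
  have hsq : Real.exp (-(m * ((x + y) / 2 / γ))) ^ 2 =
      Real.exp (-(m * (x / γ))) * Real.exp (-(m * (y / γ))) := by
    rw [sq, ← Real.exp_add, ← Real.exp_add]
    ring_nf
  have hu : Real.exp (-x) = Real.exp (-(x / 2)) ^ 2 := by
    rw [sq, ← Real.exp_add]; ring_nf
  have hv : Real.exp (-y) = Real.exp (-(y / 2)) ^ 2 := by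
    rw [sq, ← Real.exp_add]; ring_nf
  have huv : Real.exp (-((x + y) / 2)) = Real.exp (-(x / 2)) * Real.exp (-(y / 2)) := by
    rw [← Real.exp_add]; ring_nf
  have hne : Real.exp (-(x / 2)) - Real.exp (-(y / 2)) ≠ 0 := by
    rw [sub_ne_zero]
    intro h
    have := Real.exp_injective h
    exact hyx (by linarith)
  rw [ex, ey, hu, hv] at hsq
  rw [huv] at hge
  have hle := pow_le_pow_left₀ (Real.exp_pos _).le hge 2
  rw [hsq] at hle
  have hpos := mul_pos (mul_pos hb hc) (pow_pos (abs_pos.2 hne) 2)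
  rw [sq_abs] at hpos
  nlinarith

lemma exists_perturbedRate_max (hK : 1 < K) (hγ : 0 < γ) (hΔ : 0 < Δ) (hΔγ : Δ < γ)
    (hsmall : Δ < γ / (1 + Real.log K)) :
    ∃ x, 0 < x ∧ 0 < perturbedRate K γ Δ x ∧
      ∀ y, 0 < y → perturbedRate K γ Δ y ≤ perturbedRate K γ Δ x := by
  have hlog := Real.log_pos hK
  set b := (1 + Real.log K) / γ * Δ with hb
  have hb0 : 0 < b := by positivity
  have hb1 : b < 1 := by
    rw [hb, div_mul_eq_mul_div, div_lt_one hγ]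
    rwa [lt_div_iff₀' (by positivity)] at hsmall
  have hc : 0 < K * (1 - Δ / γ) := by
    have : 0 < 1 - Δ / γ := by rw [sub_pos, div_lt_one hγ]; exact hΔγ
    have : 0 < K := by linarith
    positivity
  have hlim : Tendsto (fun x => b + K * (1 - Δ / γ) * Real.exp (-x)) atTop (𝓝 b) := by
    simpa using (Real.tendsto_exp_neg_atTop_nhds_zero.const_mul (K * (1 - Δ / γ))).const_add b
  -- The smallness hypothesis is exactly `b < 1`, which makes the rate positive for large `x`.
  obtain ⟨x₁, hx₁, hx₁0⟩ := ((hlim.eventually (gt_mem_nhds hb1)).and (eventually_gt_atTop 0)).exists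
  have hr₁ : 0 < perturbedRate K γ Δ x₁ := by
    have := Real.log_neg (perturbedRate_arg_pos hK.le hγ hΔ.le hΔγ x₁) hx₁
    unfold perturbedRate
    rw [neg_mul, neg_pos]
    exact mul_neg_of_pos_of_neg (by positivity) this
  have hx₁K : Real.log K ≤ x₁ := by
    by_contra h
    exact hr₁.not_ge (perturbedRate_nonpos_of_le_log hK.le hγ hΔ.le hΔγ hx₁0 (not_le.1 h).le)
  -- Since `r(y) ≤ γ(-ln b)/y`, beyond `R` the rate cannot exceed its value at `x₁`; the maximum
  -- over `[ln K, R]` is therefore global.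
  set R := max x₁ (γ * (-Real.log b) / perturbedRate K γ Δ x₁)
  have hcont : ContinuousOn (perturbedRate K γ Δ) (Icc (Real.log K) R) := by
    intro z hz
    have hz0 : z ≠ 0 := (hlog.trans_le hz.1).ne'
    have hz1 := (perturbedRate_arg_pos hK.le hγ hΔ.le hΔγ z).ne'
    unfold perturbedRate
    refine ContinuousAt.continuousWithinAt ?_
    fun_prop (disch := assumption)
  obtain ⟨x, hx, hmax⟩ := isCompact_Icc.exists_isMaxOn
    (⟨x₁, hx₁K, le_max_left _ _⟩ : (Icc (Real.log K) R).Nonempty) hcont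
  have hle : perturbedRate K γ Δ x₁ ≤ perturbedRate K γ Δ x :=
    hmax (⟨hx₁K, le_max_left _ _⟩ : x₁ ∈ Icc (Real.log K) R)
  refine ⟨x, hlog.trans_le hx.1, hr₁.trans_le hle, fun y hy => ?_⟩
  rcases le_total y (Real.log K) with hyK | hyK
  · exact (perturbedRate_nonpos_of_le_log hK.le hγ hΔ.le hΔγ hy hyK).trans (hr₁.trans_le hle).le
  rcases le_total y R with hyR | hyR
  · exact hmax (⟨hyK, hyR⟩ : y ∈ Icc (Real.log K) R)
  refine le_trans ?_ hle
  have h1 : γ * (-Real.log b) / perturbedRate K γ Δ x₁ ≤ y := (le_max_right _ _).trans hyR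
  rw [div_le_iff₀ hr₁] at h1
  have h2 : Real.log b ≤ Real.log (b + K * (1 - Δ / γ) * Real.exp (-y)) :=
    Real.log_le_log hb0 (le_add_of_nonneg_right (mul_pos hc (Real.exp_pos _)).le)
  have h3 : perturbedRate K γ Δ y ≤ γ * (-Real.log b) / y := by
    have : γ * (-Real.log b) / y = -(γ / y) * Real.log b := by ring
    rw [this]
    unfold perturbedRate
    exact mul_le_mul_of_nonpos_left h2 (by rw [neg_nonpos]; positivity)
  refine h3.trans ?_
  rw [div_le_iff₀ hy]
  linarith

/-- For `K = 1` the logarithm's argument is the convex combination of `e^0` and `e^{-x}` with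
weights `Δ/γ` and `1 - Δ/γ`; convexity of `exp` bounds it below. -/
lemma perturbedRate_one_le (hγ : 0 < γ) (hΔ0 : 0 ≤ Δ) (hΔγ : Δ < γ) (hx : 0 < x) :
    perturbedRate 1 γ Δ x ≤ γ - Δ := by
  have h1 := exp_neg_perturbedRate_mul le_rfl hγ hΔ0 hΔγ hx
  have h0 : 0 ≤ 1 - Δ / γ := by rw [sub_nonneg, div_le_one hγ]; exact hΔγ.le
  have hconv := convexOn_exp.2 (mem_univ 0) (mem_univ (-x)) (by positivity : 0 ≤ Δ / γ) h0
    (by ring)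
  simp only [smul_eq_mul, mul_zero, zero_add, Real.exp_zero, mul_one] at hconv
  have h2 : Real.exp ((1 - Δ / γ) * -x) ≤ Real.exp (-(perturbedRate 1 γ Δ x * (x / γ))) := by
    rw [h1]
    refine hconv.trans (le_of_eq ?_)
    rw [Real.log_one]
    ring
  rw [Real.exp_le_exp] at h2
  have h3 : perturbedRate 1 γ Δ x * (x / γ) ≤ (γ - Δ) * (x / γ) := by
    have : (1 - Δ / γ) * -x = -((γ - Δ) * (x / γ)) := by field_simp
    linarith
  exact le_of_mul_le_mul_right h3 (by positivity)

/-- The limit is `-γ` times the derivative at 0 of the logarithm, whose argument equals 1 there. -/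
lemma tendsto_perturbedRate_one (hγ : 0 < γ) :
    Tendsto (perturbedRate 1 γ Δ) (𝓝[>] 0) (𝓝 (γ - Δ)) := by
  have h1 : HasDerivAt (fun x => Δ / γ + (1 - Δ / γ) * Real.exp (-x)) (-(1 - Δ / γ)) 0 := by
    have := (((hasDerivAt_neg (0 : ℝ)).exp.const_mul (1 - Δ / γ)).const_add (Δ / γ))
    simpa using this
  have h2 := h1.log (by simp)
  have h3 := h2.tendsto_slope_zero_right.const_mul (-γ)
  convert h3 using 2
  · simp only [perturbedRate, Real.log_one, smul_eq_mul, zero_add, neg_zero, Real.exp_zero]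
    ring_nf
    simp
  · simp
    field_simp
    ring

lemma isLUB_image_of_tendsto {f : ℝ → ℝ} {c : ℝ} {l : Filter ℝ} [l.NeBot] (hl : Ioi 0 ∈ l)
    (hle : ∀ x, 0 < x → f x ≤ c) (hf : Tendsto f l (𝓝 c)) : IsLUB (f '' Ioi 0) c := by
  refine ⟨?_, fun u hu => le_of_tendsto hf ?_⟩
  · rintro _ ⟨x, hx, rfl⟩
    exact hle x hx
  · filter_upwards [hl] with x hx using hu (mem_image_of_mem f hx)

lemma isLUB_perturbedRate_zero (hK : 1 < K) (hγ : 0 < γ) :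
    IsLUB (perturbedRate K γ 0 '' Ioi 0) γ := by
  have hform : ∀ x, 0 < x → perturbedRate K γ 0 x = γ - γ * Real.log K / x := by
    intro x hx
    unfold perturbedRate
    rw [zero_div, mul_zero, zero_add, sub_zero, mul_one,
      Real.log_mul (by positivity) (Real.exp_pos _).ne', Real.log_exp]
    field_simp
    ring
  refine isLUB_image_of_tendsto (l := atTop) (Ioi_mem_atTop 0) (fun x hx => ?_) ?_
  · rw [hform x hx]
    have := Real.log_pos hK
    have : 0 ≤ γ * Real.log K / x := by positivity
    linarith
  · have h : Tendsto (fun x => γ - γ * Real.log K / x) atTop (𝓝 (γ - 0)) :=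
      (tendsto_const_nhds.div_atTop tendsto_id).const_sub γ
    rw [sub_zero] at h
    refine h.congr' ?_
    filter_upwards [eventually_gt_atTop 0] with x hx using (hform x hx).symm

end PerturbedRate

/-! ### Contractivity of the perturbed evolution. -/

section Main

open Filter Topology
open scoped ComplexOrder

variable {d : ℕ} {𝓛 𝓛' : ℝ → Superoperator d} {K γ Δ x : ℝ}

lemma IsDensityMatrix.isHermitian_sub {ρ σ : Matrix (Fin d) (Fin d) ℂ} (hρ : IsDensityMatrix ρ)
    (hσ : IsDensityMatrix σ) : (ρ - σ).IsHermitian :=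
  hρ.1.isHermitian.sub hσ.1.isHermitian

lemma IsDensityMatrix.trace_sub {ρ σ : Matrix (Fin d) (Fin d) ℂ} (hρ : IsDensityMatrix ρ)
    (hσ : IsDensityMatrix σ) : (ρ - σ).trace = 0 := by
  rw [Matrix.trace_sub, hρ.2, hσ.2, sub_self]

lemma isExpContractiveWith_of_perturbedRate_pos (h𝓛 : IsTimeDependentLindbladian 𝓛)
    (h𝓛' : IsTimeDependentLindbladian 𝓛') (hcontr : IsExpContractiveWith 𝓛 K γ) (hΔ0 : 0 ≤ Δ)
    (hΔ : ∀ τ, 0 ≤ τ → ∀ X, traceNorm ((𝓛' τ - 𝓛 τ) X) ≤ Δ * traceNorm X)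
    (hΔγ : Δ < γ) (hK : 1 ≤ K) (hx : 0 < x) (hr : 0 < perturbedRate K γ Δ x) :
    IsExpContractiveWith 𝓛' (Real.exp (x * perturbedRate K γ Δ x / γ))
      (perturbedRate K γ Δ x) := by
  have hγ := hcontr.2.1
  refine ⟨Real.exp_pos _, hr, fun ρ σ hρ hσ s t hs hst => ?_⟩
  have hxK : Real.log K ≤ x := by
    by_contra h
    exact hr.not_ge (perturbedRate_nonpos_of_le_log hK hγ hΔ0 hΔγ hx (not_le.1 h).le)
  have hlen : ∀ s : ℝ, γ * (s + x / γ - s) = x := by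
    intro s
    field_simp
    ring
  have h := traceNorm_le_exp_mul_of_step (x := x / γ) (t := t) h𝓛' (by positivity) hr.le
    (fun s hs y hy htr => by
      have := traceNorm_perturbed_le (t := s + x / γ) h𝓛 h𝓛' hcontr hΔ0 hΔ hK hs hy htr
        (by rwa [hlen])
      rwa [hlen, ← exp_neg_perturbedRate_mul hK hγ hΔ0 hΔγ hx] at this)
    hs (h𝓛'.isHermitianEvolution hs (hρ.isHermitian_sub hσ))
    (by rw [timeEvolution_self]; exact hρ.trace_sub hσ) hst
  rw [timeEvolution_self] at h
  rw [abs_of_nonneg (sub_nonneg.2 hst)]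
  convert h using 4
  ring

/-- Each small `x > 0` gives the constants `exp(x r(x) / γ)` and `r(x)`; the inequality passes to
the limit `x → 0⁺`. -/
lemma isExpContractiveWith_one (h𝓛 : IsTimeDependentLindbladian 𝓛)
    (h𝓛' : IsTimeDependentLindbladian 𝓛') (hcontr : IsExpContractiveWith 𝓛 1 γ) (hΔ0 : 0 ≤ Δ)
    (hΔ : ∀ τ, 0 ≤ τ → ∀ X, traceNorm ((𝓛' τ - 𝓛 τ) X) ≤ Δ * traceNorm X) (hΔγ : Δ < γ) :
    IsExpContractiveWith 𝓛' 1 (γ - Δ) := by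
  refine ⟨one_pos, sub_pos.2 hΔγ, fun ρ σ hρ hσ s t hs hst => ?_⟩
  have hrate := tendsto_perturbedRate_one (Δ := Δ) hcontr.2.1
  have hid : Tendsto (fun x : ℝ => x) (𝓝[>] 0) (𝓝 0) :=
    tendsto_nhdsWithin_of_tendsto_nhds tendsto_id
  have h1 : Tendsto (fun x => x * perturbedRate 1 γ Δ x / γ) (𝓝[>] 0) (𝓝 0) := by
    simpa using (hid.mul hrate).div_const γ
  have h2 := (((Real.continuous_exp.tendsto _).comp h1).mul
    ((Real.continuous_exp.tendsto _).comp (hrate.neg.mul_const |t - s|))).mul_const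
    (traceNorm (ρ - σ))
  rw [Real.exp_zero] at h2
  refine ge_of_tendsto h2 ?_
  filter_upwards [self_mem_nhdsWithin, hrate.eventually (lt_mem_nhds (sub_pos.2 hΔγ))] with x hx hr
  exact (isExpContractiveWith_of_perturbedRate_pos h𝓛 h𝓛' hcontr hΔ0 hΔ hΔγ le_rfl hx hr).2.2
    ρ σ hρ hσ s t hs hst

lemma isExpContractiveWith_of_eq (h𝓛 : IsTimeDependentLindbladian 𝓛)
    (h𝓛' : IsTimeDependentLindbladian 𝓛') (hcontr : IsExpContractiveWith 𝓛 K γ)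
    (hΔ : ∀ τ, 0 ≤ τ → ∀ X, traceNorm ((𝓛' τ - 𝓛 τ) X) ≤ 0 * traceNorm X) :
    IsExpContractiveWith 𝓛' K γ := by
  refine ⟨hcontr.1, hcontr.2.1, fun ρ σ hρ hσ s t hs hst => ?_⟩
  have hX := hρ.isHermitian_sub hσ
  have h1 := (h𝓛.isHermitianEvolution hs hX).traceNorm_sub_le (h𝓛'.isHermitianEvolution hs hX)
    h𝓛 h𝓛' hs hst (c := 0) fun τ hτ => by simpa using hΔ τ (hs.trans hτ) (timeEvolution 𝓛' τ s _)
  simp only [timeEvolution_self, sub_self, traceNorm_zero, zero_mul, add_zero] at h1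
  rw [sub_eq_zero.1 (eq_zero_of_traceNorm_le_zero h1)]
  exact hcontr.2.2 ρ σ hρ hσ s t hs hst

/-- At `t = s` a constant below 1 forces `ρ = σ`, so both sides vanish. -/
lemma isExpContractiveWith_of_lt_one (h𝓛' : IsTimeDependentLindbladian 𝓛')
    (hcontr : IsExpContractiveWith 𝓛 K γ) (hK : K < 1) : IsExpContractiveWith 𝓛' K γ := by
  refine ⟨hcontr.1, hcontr.2.1, fun ρ σ hρ hσ s t hs hst => ?_⟩
  have h1 := hcontr.2.2 ρ σ hρ hσ s s hs le_rfl
  rw [timeEvolution_self, sub_self, abs_zero, mul_zero, Real.exp_zero, mul_one] at h1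
  have h2 : traceNorm (ρ - σ) ≤ 0 := by
    have := traceNorm_nonneg (ρ - σ)
    nlinarith
  have h3 := (h𝓛'.isHermitianEvolution hs (hρ.isHermitian_sub hσ)).traceNorm_le h𝓛' hs hst
  rw [timeEvolution_self] at h3
  refine (h3.trans h2).trans ?_
  have := hcontr.1
  have := traceNorm_nonneg (ρ - σ)
  positivity

end Main

/-- Stability of exponential contractivity under small Lindbladian perturbations. -/
theorem mainTheorem3 {d : ℕ} (𝓛 𝓛' : ℝ → Superoperator d) (K γ Δ : ℝ)
    (h𝓛 : IsTimeDependentLindbladian 𝓛) (h𝓛' : IsTimeDependentLindbladian 𝓛')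
    (hcontr : IsExpContractiveWith 𝓛 K γ)
    (hΔ : IsLUB ((fun t : ℝ => superopNorm (𝓛' t - 𝓛 t)) '' Set.Ici 0) Δ)
    (hsmall : Δ < γ / (1 + Real.log K)) :
    IsExpContractive 𝓛' ∧
    (1 < K → 0 < Δ →
      ∃ x : ℝ, 0 < x ∧
        (∀ y : ℝ, 0 < y → y ≠ x → perturbedRate K γ Δ y < perturbedRate K γ Δ x) ∧
        IsExpContractiveWith 𝓛' (Real.exp (x * perturbedRate K γ Δ x / γ))
          (perturbedRate K γ Δ x)) ∧
    (K = 1 →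
      IsLUB (perturbedRate K γ Δ '' Set.Ioi 0) (γ - Δ) ∧
      Filter.Tendsto (perturbedRate K γ Δ) (nhdsWithin 0 (Set.Ioi 0)) (nhds (γ - Δ)) ∧
      IsExpContractiveWith 𝓛' 1 (γ - Δ)) ∧
    (1 < K → Δ = 0 → IsLUB (perturbedRate K γ Δ '' Set.Ioi 0) γ) ∧
    (Δ = 0 → IsExpContractiveWith 𝓛' K γ) := by
  have hγ := hcontr.2.1
  have hmem : ∀ τ, 0 ≤ τ → superopNorm (𝓛' τ - 𝓛 τ) ≤ Δ :=
    fun τ hτ => hΔ.1 ⟨τ, hτ, rfl⟩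
  have hΔ0 : 0 ≤ Δ := (superopNorm_nonneg _).trans (hmem 0 le_rfl)
  have hbound : ∀ τ, 0 ≤ τ → ∀ X, traceNorm ((𝓛' τ - 𝓛 τ) X) ≤ Δ * traceNorm X :=
    fun τ hτ X => (traceNorm_superop_apply_le _ X).trans
      (mul_le_mul_of_nonneg_right (hmem τ hτ) (traceNorm_nonneg X))
  have hΔγ : 1 ≤ K → Δ < γ := fun hK =>
    hsmall.trans_le (div_le_self hγ.le (by linarith [Real.log_nonneg hK]))
  have hzero : Δ = 0 → IsExpContractiveWith 𝓛' K γ := fun h =>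
    isExpContractiveWith_of_eq h𝓛 h𝓛' hcontr (h ▸ hbound)
  have hone : K = 1 → IsExpContractiveWith 𝓛' 1 (γ - Δ) := fun h =>
    isExpContractiveWith_one h𝓛 h𝓛' (h ▸ hcontr) hΔ0 hbound (hΔγ h.ge)
  have hmax : 1 < K → 0 < Δ →
      ∃ x : ℝ, 0 < x ∧
        (∀ y : ℝ, 0 < y → y ≠ x → perturbedRate K γ Δ y < perturbedRate K γ Δ x) ∧
        IsExpContractiveWith 𝓛' (Real.exp (x * perturbedRate K γ Δ x / γ))
          (perturbedRate K γ Δ x) := by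
    intro hK hΔpos
    obtain ⟨x, hx, hr, hle⟩ := exists_perturbedRate_max hK hγ hΔpos (hΔγ hK.le) hsmall
    exact ⟨x, hx,
      fun y hy hyx => perturbedRate_lt_of_isMaxOn hK.le hγ hΔpos (hΔγ hK.le) hx hle hy hyx,
      isExpContractiveWith_of_perturbedRate_pos h𝓛 h𝓛' hcontr hΔ0 hbound (hΔγ hK.le) hK.le hx hr⟩
  refine ⟨?_, hmax, fun hK => ?_, fun hK h => h ▸ isLUB_perturbedRate_zero hK hγ, hzero⟩
  · rcases lt_trichotomy K 1 with hK | hK | hK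
    · exact ⟨K, γ, isExpContractiveWith_of_lt_one h𝓛' hcontr hK⟩
    · exact ⟨1, γ - Δ, hone hK⟩
    · rcases hΔ0.eq_or_lt with h | h
      · exact ⟨K, γ, hzero h.symm⟩
      · obtain ⟨x, -, -, hx⟩ := hmax hK h
        exact ⟨_, _, hx⟩
  · have hlt := hΔγ hK.ge
    refine ⟨?_, ?_, hone hK⟩
    · subst hK
      exact isLUB_image_of_tendsto self_mem_nhdsWithin
        (fun x hx => perturbedRate_one_le hγ hΔ0 hlt hx) (tendsto_perturbedRate_one hγ)
    · subst hK
      exact tendsto_perturbedRate_one hγ
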